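/- There exists a finitely generated simple left orderable group $G$ that has infinite commutator width. Here $G$ is left orderable if it admits a total order $<$ such that $b<c$ implies $ab<ac$ for all $a,b,c\in G$; and infinite commutator width means that for each $n\in\mathbf{N}$ there is an element $g$ of the commutator subgroup $[G,G]$ that cannot be expressed as a product of fewer than $n$ commutators $[x,y]$ with $x,y\in G$. -/

import Mathlib

/-- A group is left orderable if it carries a total order invariant under left multiplication. -/
def IsLeftOrderable (G : Type*) [Group G] : Prop :=
  ∃ _ : LinearOrder G, ∀ a b c : G, b < c → a * b < a * c

/-- `g` is a product of exactly `k` commutators of `G` (the empty product is `1`). -/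
def IsProductOfCommutators {G : Type*} [Group G] (k : ℕ) (g : G) : Prop :=
  ∃ l : List G, l.length = k ∧ (∀ x ∈ l, x ∈ commutatorSet G) ∧ l.prod = g

/-- A group has infinite commutator width if, for each `n`, its commutator subgroup contains an
element that is not a product of fewer than `n` commutators. -/
def HasInfiniteCommutatorWidth (G : Type*) [Group G] : Prop :=
  ∀ n : ℕ, ∃ g ∈ commutator G, ∀ k < n, ¬ IsProductOfCommutators k g

/-!
The group acts on a countable line and commutes with a translation `T` of it, so it acts on the
quotient circle; the translation number of such an action is a quasimorphism, and an unbounded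
quasimorphism forces infinite commutator width. A group of this kind that contains a nontrivial
power of `T` has a centre and is not simple, so the point is to keep these powers out. For this the
points of the line are coloured by integers, `T` raises every colour by `1`, and the group preserves
colours.

* All colours are dense in the line. Back and forth (`ColouredPartialIso.exists_orderIso`, a
  coloured Cantor theorem) then provides as many colour-preserving automorphisms commuting with `T`
  as needed (`exists_periodic_automorphism`).
* `LiftedLine.projectiveGroup` is a finitely generated perfect group of automorphisms of the
  universal cover of the projective line: it is generated by lifts of `x + 1`, `-1/x`, `4x`, `9x`,
  and is perfect because `4 - 1` and `9 - 1` are coprime and because rotations and dilations are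
  products of unipotents (`closure_le_commutator_of_relations`). It respects the colouring of a real
  `x` by the field `ℚ(x)`, and it contracts compact parts of one affine chart arbitrarily.
* Embed the universal cover of the projective line as an arc of the circle and let the
  group act there, trivially outside the arc. By `CutCircle.exists_gluing` there is a conjugate copy
  of this action for which the contracting charts of the two copies cover the circle. The group `Γ`
  generated by the two copies is the required one: it compresses the support of each copy into any
  given interval (`CoveringContraction.exists_compress_set`).
* Simplicity: a nontrivial `f` in a normal subgroup `N` moves a small interval off all its
  `T`-translates, because `f` preserves colours and the powers of `T` do not
  (`IsDegree.exists_wandering`). Hence `N` contains the commutators of elements of `Γ` supported in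
  that interval and its translates, hence both copies of the perfect group
  (`le_of_normalized`).
* `Γ` is left orderable since it acts faithfully on a countable linear order, and pushing a point
  through both charts in turn moves it beyond its `T`-translate, so the translation quasimorphism is
  unbounded (`CoveringContraction.hasInfiniteCommutatorWidth`).
-/

/-! ### Coloured countable dense orders -/

/-- Every colour occurs in every open interval and in every open ray of the coloured order. -/
structure ColourDense {α ι : Type*} [LinearOrder α] (κ : α → ι) : Prop where
  between : ∀ a b, a < b → ∀ i, ∃ c, a < c ∧ c < b ∧ κ c = i
  above : ∀ a i, ∃ c, a < c ∧ κ c = i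
  below : ∀ a i, ∃ c, c < a ∧ κ c = i

namespace ColourDense

variable {α β ι : Type*} [LinearOrder α] [LinearOrder β] {κ : α → ι} {μ : β → ι}

lemma exists_between_finsets [Nonempty α] (h : ColourDense κ) (lo hi : Finset α)
    (hlt : ∀ x ∈ lo, ∀ y ∈ hi, x < y) (i : ι) :
    ∃ c, κ c = i ∧ (∀ x ∈ lo, x < c) ∧ ∀ y ∈ hi, c < y := by
  rcases lo.eq_empty_or_nonempty with rfl | hlo <;> rcases hi.eq_empty_or_nonempty with rfl | hhi
  · obtain ⟨c, -, hc⟩ := h.above (Classical.arbitrary α) i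
    exact ⟨c, hc, by simp, by simp⟩
  · obtain ⟨c, hc, hci⟩ := h.below (hi.min' hhi) i
    exact ⟨c, hci, by simp, fun y hy => hc.trans_le (hi.min'_le y hy)⟩
  · obtain ⟨c, hc, hci⟩ := h.above (lo.max' hlo) i
    exact ⟨c, hci, fun x hx => (lo.le_max' x hx).trans_lt hc, by simp⟩
  · obtain ⟨c, hc, hc', hci⟩ :=
      h.between _ _ (hlt _ (lo.max'_mem hlo) _ (hi.min'_mem hhi)) i
    exact ⟨c, hci, fun x hx => (lo.le_max' x hx).trans_lt hc,
      fun y hy => hc'.trans_le (hi.min'_le y hy)⟩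

end ColourDense

/-- Finite partial isomorphisms between two coloured orders, encoded as finite sets of pairs. -/
def ColouredPartialIso {α β ι : Type*} [LinearOrder α] [LinearOrder β] (κ : α → ι) (μ : β → ι) :
    Type _ :=
  { f : Finset (α × β) //
    (∀ p ∈ f, ∀ q ∈ f, p.1 < q.1 ↔ p.2 < q.2) ∧ ∀ p ∈ f, μ p.2 = κ p.1 }

namespace ColouredPartialIso

variable {α β ι : Type*} [LinearOrder α] [LinearOrder β] {κ : α → ι} {μ : β → ι}

instance : Preorder (ColouredPartialIso κ μ) := Preorder.lift Subtype.val

lemma exists_extend_left [Nonempty β] (hμ : ColourDense μ)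
    (f : ColouredPartialIso κ μ) (a : α) : ∃ g, f ≤ g ∧ ∃ b, (a, b) ∈ g.1 := by
  classical
  by_cases h : ∃ b, (a, b) ∈ f.1
  · exact ⟨f, le_rfl, h⟩
  obtain ⟨f, hf, hc⟩ := f
  obtain ⟨b, hbc, hlo, hhi⟩ := hμ.exists_between_finsets
    ((f.filter fun p => p.1 < a).image Prod.snd) ((f.filter fun p => a < p.1).image Prod.snd)
    (by
      simp only [Finset.mem_image, Finset.mem_filter]
      rintro _ ⟨p, ⟨hp, hpa⟩, rfl⟩ _ ⟨q, ⟨hq, hqa⟩, rfl⟩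
      exact (hf p hp q hq).1 (hpa.trans hqa)) (κ a)
  have hne : ∀ p ∈ f, p.1 ≠ a := fun p hp e => h ⟨p.2, by rw [← e]; exact hp⟩
  have hl : ∀ p ∈ f, p.1 < a → p.2 < b := fun p hp hpa =>
    hlo _ (Finset.mem_image_of_mem _ (Finset.mem_filter.2 ⟨hp, hpa⟩))
  have hr : ∀ p ∈ f, a < p.1 → b < p.2 := fun p hp hpa =>
    hhi _ (Finset.mem_image_of_mem _ (Finset.mem_filter.2 ⟨hp, hpa⟩))
  refine ⟨⟨insert (a, b) f, ?_, ?_⟩, Finset.subset_insert _ _, b, Finset.mem_insert_self _ _⟩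
  · intro p hp q hq
    rw [Finset.mem_insert] at hp hq
    rcases hp with rfl | hp <;> rcases hq with rfl | hq
    · simp
    · refine ⟨hr q hq, fun hb => ?_⟩
      rcases lt_or_gt_of_ne (hne q hq) with h1 | h1
      · exact absurd (hl q hq h1) hb.asymm
      · exact h1
    · refine ⟨hl p hp, fun hb => ?_⟩
      rcases lt_or_gt_of_ne (hne p hp) with h1 | h1
      · exact h1
      · exact absurd (hr p hp h1) hb.asymm
    · exact hf p hp q hq
  · intro p hp
    rw [Finset.mem_insert] at hp
    rcases hp with rfl | hp
    · exact hbc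
    · exact hc p hp

/-- The inverse of a finite partial isomorphism. -/
def symm (f : ColouredPartialIso κ μ) : ColouredPartialIso μ κ :=
  ⟨f.1.map (Equiv.prodComm α β).toEmbedding, by
    obtain ⟨f, hf, hc⟩ := f
    constructor
    · simp only [Finset.mem_map_equiv, Equiv.prodComm_symm, Equiv.prodComm_apply]
      exact fun p hp q hq => (hf _ hp _ hq).symm
    · simp only [Finset.mem_map_equiv, Equiv.prodComm_symm, Equiv.prodComm_apply]
      exact fun p hp => (hc _ hp).symm⟩

lemma mem_symm {f : ColouredPartialIso κ μ} {a : α} {b : β} :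
    (b, a) ∈ f.symm.1 ↔ (a, b) ∈ f.1 := by
  simp [symm, Finset.mem_map_equiv]

lemma exists_extend_right [Nonempty α] (hκ : ColourDense κ)
    (f : ColouredPartialIso κ μ) (b : β) : ∃ g, f ≤ g ∧ ∃ a, (a, b) ∈ g.1 := by
  obtain ⟨g, hg, a, ha⟩ := exists_extend_left hκ f.symm b
  exact ⟨g.symm, fun ⟨x, y⟩ hp => mem_symm.2 (hg (mem_symm.2 hp)), a, mem_symm.2 ha⟩

/-- Back and forth: a finite partial isomorphism between countable coloured orders in which all
colours are dense extends to an isomorphism. This is the coloured form of Cantor's theorem. -/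
theorem exists_orderIso [Countable α] [Countable β] [Nonempty α] [Nonempty β]
    (hκ : ColourDense κ) (hμ : ColourDense μ) (f₀ : ColouredPartialIso κ μ) :
    ∃ e : α ≃o β, (∀ a, μ (e a) = κ a) ∧ ∀ p ∈ f₀.1, e p.1 = p.2 := by
  cases nonempty_encodable α
  cases nonempty_encodable β
  let 𝒟 : α ⊕ β → Order.Cofinal (ColouredPartialIso κ μ) := fun p => Sum.recOn p
    (fun a => ⟨{g | ∃ b, (a, b) ∈ g.1}, fun f =>
      let ⟨g, hg, hb⟩ := exists_extend_left hμ f a; ⟨g, hb, hg⟩⟩)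
    (fun b => ⟨{g | ∃ a, (a, b) ∈ g.1}, fun f =>
      let ⟨g, hg, hb⟩ := exists_extend_right hκ f b; ⟨g, hb, hg⟩⟩)
  let I := Order.idealOfCofinals f₀ 𝒟
  have hF : ∀ a, ∃ b, ∃ f ∈ I, (a, b) ∈ f.1 := fun a => by
    obtain ⟨f, ⟨b, hb⟩, hf⟩ := Order.cofinal_meets_idealOfCofinals f₀ 𝒟 (Sum.inl a)
    exact ⟨b, f, hf, hb⟩
  have hG : ∀ b, ∃ a, ∃ f ∈ I, (a, b) ∈ f.1 := fun b => by
    obtain ⟨f, ⟨a, ha⟩, hf⟩ := Order.cofinal_meets_idealOfCofinals f₀ 𝒟 (Sum.inr b)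
    exact ⟨a, f, hf, ha⟩
  have key : ∀ a b a' b', (∃ f ∈ I, (a, b) ∈ f.1) → (∃ f ∈ I, (a', b') ∈ f.1) →
      (a < a' ↔ b < b') := by
    rintro a b a' b' ⟨f, hf, h1⟩ ⟨g, hg, h2⟩
    obtain ⟨m, -, fm, gm⟩ := I.directed _ hf _ hg
    exact m.2.1 _ (fm h1) _ (gm h2)
  have uniq : ∀ a b b', (∃ f ∈ I, (a, b) ∈ f.1) → (∃ f ∈ I, (a, b') ∈ f.1) → b = b' := by
    intro a b b' h h'
    refine le_antisymm (not_lt.1 fun hh => ?_) (not_lt.1 fun hh => ?_)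
    · exact lt_irrefl _ ((key _ _ _ _ h' h).2 hh)
    · exact lt_irrefl _ ((key _ _ _ _ h h').2 hh)
  choose F hF using hF
  choose G hG using hG
  have hmono : StrictMono F := fun a a' h => (key _ _ _ _ (hF a) (hF a')).1 h
  have hsurj : Function.Surjective F := fun b => ⟨G b, uniq _ _ _ (hF (G b)) (hG b)⟩
  refine ⟨hmono.orderIsoOfSurjective F hsurj, fun a => ?_, fun p hp => ?_⟩
  · obtain ⟨f, -, h⟩ := hF a
    exact f.2.2 _ h
  · exact uniq _ _ _ (hF p.1) ⟨f₀, Order.mem_idealOfCofinals _ _, hp⟩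

end ColouredPartialIso

/-! ### A coloured set of reals -/

lemma countable_subfieldClosure_singleton (x : ℝ) :
    (Subfield.closure {x} : Set ℝ).Countable := by
  rw [← Cardinal.le_aleph0_iff_set_countable]
  refine (Subfield.cardinalMk_closure_le_max {x}).trans ?_
  simp

lemma exists_seq_subfieldClosure_injective :
    ∃ α : ℤ → ℝ, (Function.Injective fun m => Subfield.closure {α m}) ∧
      ∀ m, Subfield.closure {α m} ≠ Subfield.closure {0} := by
  let S : Set (Subfield ℝ) := Set.range (fun x : ℝ => Subfield.closure {x}) \
    {Subfield.closure {0}}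
  have hS : S.Infinite := by
    intro hfin
    have h1 : (Set.range fun x : ℝ => Subfield.closure {x}).Countable :=
      (Set.Finite.of_sdiff hfin (Set.finite_singleton _)).countable
    have h2 : (⋃ A ∈ Set.range fun x : ℝ => Subfield.closure {x}, (A : Set ℝ)).Countable :=
      h1.biUnion (by rintro _ ⟨x, rfl⟩; exact countable_subfieldClosure_singleton x)
    refine Cardinal.not_countable_real (h2.mono fun x _ => ?_)
    exact Set.mem_biUnion ⟨x, rfl⟩ (Subfield.subset_closure rfl)
  let f : ℤ ↪ S := (Denumerable.equiv₂ ℤ ℕ).toEmbedding.trans hS.natEmbedding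
  choose α hα using fun m => (f m).2.1
  refine ⟨α, fun m n h => f.injective (Subtype.ext ?_), fun m h => (f m).2.2 ?_⟩
  · simpa only [hα] using h
  · rw [← hα m]; exact h

/-- Representatives of the colours: reals generating pairwise distinct subfields, none of them the
prime field. -/
noncomputable def colourGen : ℤ → ℝ := exists_seq_subfieldClosure_injective.choose

lemma colourGen_injective : Function.Injective fun m => Subfield.closure {colourGen m} :=
  exists_seq_subfieldClosure_injective.choose_spec.1

lemma closure_colourGen_ne (m : ℤ) : Subfield.closure {colourGen m} ≠ Subfield.closure {0} :=
  exists_seq_subfieldClosure_injective.choose_spec.2 m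

/-- The reals that generate the same subfield as one of the `colourGen m`. -/
@[ext] structure ColouredReal : Type where
  /-- The underlying real number. -/
  val : ℝ
  exists_colour : ∃ m, Subfield.closure {val} = Subfield.closure {colourGen m}

namespace ColouredReal

lemma val_injective : Function.Injective val := fun _ _ h => ColouredReal.ext h

noncomputable instance : LinearOrder ColouredReal := LinearOrder.lift' val val_injective

/-- The index `m` of the subfield generated by a coloured real. -/
noncomputable def colour (x : ColouredReal) : ℤ := x.exists_colour.choose

lemma closure_eq (x : ColouredReal) :
    Subfield.closure {x.val} = Subfield.closure {colourGen x.colour} := x.exists_colour.choose_spec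

lemma colour_eq_iff {x : ColouredReal} {m : ℤ} :
    x.colour = m ↔ Subfield.closure {x.val} = Subfield.closure {colourGen m} := by
  refine ⟨fun h => h ▸ x.closure_eq, fun h => colourGen_injective ?_⟩
  exact x.closure_eq.symm.trans h

lemma val_ne_zero (x : ColouredReal) : x.val ≠ 0 := fun h =>
  closure_colourGen_ne x.colour (by rw [← x.closure_eq, h])

lemma val_pos_or_neg (x : ColouredReal) : x.val < 0 ∨ 0 < x.val := lt_or_gt_of_ne x.val_ne_zero

/-- Replace a coloured real by another generator of the same subfield. -/
def copy (x : ColouredReal) (y : ℝ) (h : Subfield.closure {y} = Subfield.closure {x.val}) :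
    ColouredReal := ⟨y, x.colour, h.trans x.closure_eq⟩

@[simp] lemma colour_copy (x : ColouredReal) (y : ℝ) (h) : (x.copy y h).colour = x.colour :=
  colour_eq_iff.2 (h.trans x.closure_eq)

lemma closure_eq_of_mem {x y : ℝ} (h : x ∈ Subfield.closure {y}) (h' : y ∈ Subfield.closure {x}) :
    Subfield.closure {x} = Subfield.closure {y} :=
  le_antisymm (Subfield.closure_le.2 (by simpa using h)) (Subfield.closure_le.2 (by simpa using h'))

lemma mem_closure_self (x : ℝ) : x ∈ Subfield.closure {x} := Subfield.subset_closure rfl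

lemma closure_add_ratCast (x : ℝ) (q : ℚ) :
    Subfield.closure {x + q} = Subfield.closure {x} := by
  refine closure_eq_of_mem (add_mem (mem_closure_self x) (SubfieldClass.ratCast_mem _ q)) ?_
  have := sub_mem (mem_closure_self (x + q)) (SubfieldClass.ratCast_mem (Subfield.closure {x + q}) q)
  simpa using this

lemma closure_mul_ratCast (x : ℝ) {q : ℚ} (hq : q ≠ 0) :
    Subfield.closure {x * q} = Subfield.closure {x} := by
  refine closure_eq_of_mem (mul_mem (mem_closure_self x) (SubfieldClass.ratCast_mem _ q)) ?_
  have := div_mem (mem_closure_self (x * q)) (SubfieldClass.ratCast_mem (Subfield.closure {x * q}) q)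
  rwa [mul_div_cancel_right₀ _ (by exact_mod_cast hq)] at this

lemma closure_neg_inv (x : ℝ) : Subfield.closure {-x⁻¹} = Subfield.closure {x} := by
  refine closure_eq_of_mem (neg_mem (inv_mem (mem_closure_self x))) ?_
  have := neg_mem (inv_mem (mem_closure_self (-x⁻¹)))
  rwa [inv_neg, inv_inv, neg_neg] at this

/-- Translation by a rational number. -/
noncomputable def add (x : ColouredReal) (q : ℚ) : ColouredReal :=
  x.copy (x.val + q) (closure_add_ratCast _ _)

/-- Multiplication by a nonzero rational number. -/
noncomputable def mul (x : ColouredReal) (q : ℚ) (hq : q ≠ 0) : ColouredReal :=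
  x.copy (x.val * q) (closure_mul_ratCast _ hq)

/-- The map `x ↦ -1/x`. -/
noncomputable def negInv (x : ColouredReal) : ColouredReal := x.copy (-x.val⁻¹) (closure_neg_inv _)

@[simp] lemma val_add (x : ColouredReal) (q : ℚ) : (x.add q).val = x.val + q := rfl
@[simp] lemma val_mul (x : ColouredReal) (q : ℚ) (hq) : (x.mul q hq).val = x.val * q := rfl
@[simp] lemma val_negInv (x : ColouredReal) : x.negInv.val = -x.val⁻¹ := rfl
@[simp] lemma colour_add (x : ColouredReal) (q : ℚ) : (x.add q).colour = x.colour :=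
  colour_copy ..
@[simp] lemma colour_mul (x : ColouredReal) (q : ℚ) (hq) : (x.mul q hq).colour = x.colour :=
  colour_copy ..
@[simp] lemma colour_negInv (x : ColouredReal) : x.negInv.colour = x.colour := colour_copy ..

instance : Nonempty ColouredReal := ⟨⟨colourGen 0, 0, rfl⟩⟩

instance : Countable ColouredReal := by
  have h : (⋃ m, (Subfield.closure {colourGen m} : Set ℝ)).Countable :=
    Set.countable_iUnion fun m => countable_subfieldClosure_singleton _
  refine Set.countable_univ_iff.1 ((h.preimage_of_injOn val_injective.injOn).mono ?_)
  rintro x -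
  exact Set.mem_iUnion.2 ⟨x.colour, x.closure_eq ▸ mem_closure_self x.val⟩

/-- The chosen real of colour `m`. -/
noncomputable def gen (m : ℤ) : ColouredReal := ⟨colourGen m, m, rfl⟩

lemma val_gen (m : ℤ) : (gen m).val = colourGen m := rfl

lemma colour_gen (m : ℤ) : (gen m).colour = m := colour_eq_iff.2 rfl

lemma exists_between_real {a b : ℝ} (h : a < b) (m : ℤ) :
    ∃ c : ColouredReal, a < c.val ∧ c.val < b ∧ c.colour = m := by
  obtain ⟨q, hq, hq'⟩ := exists_rat_btwn (sub_lt_sub_right h (colourGen m))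
  refine ⟨(gen m).add q, ?_, ?_, ?_⟩
  · rw [val_add, val_gen]; linarith
  · rw [val_add, val_gen]; linarith
  · rw [colour_add, colour_gen]

lemma colourDense : ColourDense colour where
  between _ _ h i := exists_between_real h i
  above a i :=
    let ⟨c, h, _, hc⟩ := exists_between_real (lt_add_one a.val) i; ⟨c, h, hc⟩
  below a i :=
    let ⟨c, _, h, hc⟩ := exists_between_real (sub_one_lt a.val) i; ⟨c, h, hc⟩

end ColouredReal

/-! ### A perfect group acting on the universal cover of the projective line -/

open scoped commutatorElement

/-- The subgroup of a group generated by `s`, `w`, `a²`, `b²` is perfect when `s`, `w`, `a`, `b`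
satisfy the relations of translation by `1`, the rotation `x ↦ -1/x`, and multiplication by `2` and
by `3` on the projective line. -/
lemma closure_le_commutator_of_relations {Γ : Type*} [Group Γ] (s w a b : Γ)
    (has : a * s = s ^ 2 * a) (hbs : b * s = s ^ 3 * b) (hw : w * s⁻¹ * w = s * w * s)
    (haw : a * w * a = w) (hbw : b * w * b = w) :
    Subgroup.closure {s, w, a ^ 2, b ^ 2} ≤
      ⁅Subgroup.closure {s, w, a ^ 2, b ^ 2}, Subgroup.closure {s, w, a ^ 2, b ^ 2}⁆ := by
  set K := Subgroup.closure {s, w, a ^ 2, b ^ 2} with hK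
  have hsK : s ∈ K := Subgroup.subset_closure (by simp)
  have hwK : w ∈ K := Subgroup.subset_closure (by simp)
  have haK : a ^ 2 ∈ K := Subgroup.subset_closure (by simp)
  have hbK : b ^ 2 ∈ K := Subgroup.subset_closure (by simp)
  have hCK : ⁅K, K⁆ ≤ K := Subgroup.commutator_le_self K
  have hconj : ∀ k ∈ K, ∀ c ∈ ⁅K, K⁆, k * c * k⁻¹ ∈ ⁅K, K⁆ := fun k hk c hc => by
    have := mul_mem (Subgroup.commutator_mem_commutator hk (hCK hc)) hc
    simpa [commutatorElement_def] using this
  have hconj' : ∀ k ∈ K, ∀ c ∈ ⁅K, K⁆, k⁻¹ * c * k ∈ ⁅K, K⁆ := fun k hk c hc => by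
    simpa using hconj k⁻¹ (inv_mem hk) c hc
  have hapow : ∀ n : ℕ, a * s ^ n = s ^ (2 * n) * a := fun n => by
    have h : a * s * a⁻¹ = s ^ 2 := by rw [has]; group
    have := congrArg (· ^ n) h
    simp only [conj_pow, ← pow_mul] at this
    rw [← this]; group
  have hbpow : ∀ n : ℕ, b * s ^ n = s ^ (3 * n) * b := fun n => by
    have h : b * s * b⁻¹ = s ^ 3 := by rw [hbs]; group
    have := congrArg (· ^ n) h
    simp only [conj_pow, ← pow_mul] at this
    rw [← this]; group
  -- `[a², s] = s³` and `[b², s] = s⁸`, and the exponents are coprime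
  have hs3 : s ^ 3 ∈ ⁅K, K⁆ := by
    have := Subgroup.commutator_mem_commutator haK hsK
    have e : ⁅a ^ 2, s⁆ = s ^ 3 := by
      have : a ^ 2 * s = s ^ 4 * a ^ 2 := by
        rw [pow_two, mul_assoc, has, ← mul_assoc, hapow, mul_assoc]
      rw [commutatorElement_def, this]; group
    rwa [e] at this
  have hs8 : s ^ 8 ∈ ⁅K, K⁆ := by
    have := Subgroup.commutator_mem_commutator hbK hsK
    have e : ⁅b ^ 2, s⁆ = s ^ 8 := by
      have : b ^ 2 * s = s ^ 9 * b ^ 2 := by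
        rw [pow_two, mul_assoc, hbs, ← mul_assoc, hbpow, mul_assoc]
      rw [commutatorElement_def, this]; group
    rwa [e] at this
  have hs : s ∈ ⁅K, K⁆ := by
    have := mul_mem (pow_mem hs3 3) (inv_mem hs8)
    have e : (s ^ 3) ^ 3 * (s ^ 8)⁻¹ = s := by group
    rwa [e] at this
  have hw' : w = s * (w * s * w⁻¹) * s := by
    calc w = w * s⁻¹ * w * w⁻¹ * s := by group
      _ = _ := by rw [hw]; group
  have hwC : w ∈ ⁅K, K⁆ := by
    rw [hw']; exact mul_mem (mul_mem hs (hconj w hwK s hs)) hs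
  -- a dilation `t²` is the product of `t w t⁻¹ = t² w`, a product of unipotents, and `w⁻¹`
  have dil : ∀ (t : Γ) (n : ℕ), t ^ 2 ∈ K → t * s = s ^ n * t → t * w * t = w →
      t ^ 2 ∈ ⁅K, K⁆ := by
    intro t n htK hts htw
    have h1 : t * w = w * t⁻¹ := eq_mul_inv_of_mul_eq htw
    have h2 : t * s * t⁻¹ = s ^ n := by rw [hts]; group
    have h3 : t ^ 2 = (s ^ n * (w * ((t ^ 2)⁻¹ * s ^ n * t ^ 2) * w⁻¹) * s ^ n) * w⁻¹ := by
      rw [← h2]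
      calc t ^ 2 = t * (t * w) * w⁻¹ := by rw [mul_assoc, mul_inv_cancel_right, pow_two]
        _ = t * w * t⁻¹ * w⁻¹ := by conv_lhs => rw [h1, ← mul_assoc]
        _ = t * (s * (w * s * w⁻¹) * s) * t⁻¹ * w⁻¹ := by rw [← hw']
        _ = (t * s * t⁻¹) * ((t * w) * s * (t * w)⁻¹) * (t * s * t⁻¹) * w⁻¹ := by group
        _ = _ := by rw [h1]; group
    rw [h3]
    exact mul_mem (mul_mem (mul_mem (pow_mem hs n)
      (hconj w hwK _ (hconj' _ htK _ (pow_mem hs n)))) (pow_mem hs n)) (inv_mem hwC)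
  rw [hK, Subgroup.closure_le]
  rintro x (rfl | rfl | rfl | rfl)
  · exact hs
  · exact hwC
  · exact dil a 2 haK has haw
  · exact dil b 3 hbK hbs hbw

/-- The group of colour-preserving automorphisms of a coloured order. -/
def colourAut {α ι : Type*} [LinearOrder α] (κ : α → ι) : Subgroup (α ≃o α) where
  carrier := {g | ∀ x, κ (g x) = κ x}
  mul_mem' {g h} hg hh x := (hg (h x)).trans (hh x)
  one_mem' _ := rfl
  inv_mem' {g} hg x := by
    have := hg (g⁻¹ x)
    rw [RelIso.apply_inv_self] at this
    exact this.symm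

/-- A coloured model of the universal cover of the real projective line: the pair `(n, x)` is the
point `x` on the `n`-th lift of the affine line. The lifts of `∞` are not part of the model. -/
abbrev LiftedLine : Type := ℤ ×ₗ ColouredReal

namespace LiftedLine

/-- The point `x` on the `n`-th lift of the affine line. -/
abbrev mk (n : ℤ) (x : ColouredReal) : LiftedLine := toLex (n, x)

/-- The index of the lift of the affine line that contains a point. -/
def level (y : LiftedLine) : ℤ := (ofLex y).1

/-- The affine coordinate of a point. -/
def coord (y : LiftedLine) : ColouredReal := (ofLex y).2

/-- The colour of a point is that of its affine coordinate. -/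
noncomputable def colour (y : LiftedLine) : ℤ := y.coord.colour

@[simp] lemma level_mk (n x) : (mk n x).level = n := rfl
@[simp] lemma coord_mk (n x) : (mk n x).coord = x := rfl
@[simp] lemma mk_level_coord (y : LiftedLine) : mk y.level y.coord = y := rfl

lemma mk_lt_mk {m n : ℤ} {x y : ColouredReal} :
    mk m x < mk n y ↔ m < n ∨ m = n ∧ x.val < y.val := Prod.Lex.toLex_lt_toLex

lemma ext {y z : LiftedLine} (h : y.level = z.level) (h' : y.coord.val = z.coord.val) : y = z := by
  rw [← mk_level_coord y, ← mk_level_coord z, h, ColouredReal.ext h']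

/-- The lift of `x ↦ x + 1`. -/
noncomputable def translation : LiftedLine ≃o LiftedLine :=
  StrictMono.orderIsoOfRightInverse (fun y => mk y.level (y.coord.add 1))
    (by
      intro y z h
      rw [← mk_level_coord y, ← mk_level_coord z, mk_lt_mk] at h
      rw [mk_lt_mk]
      rcases h with h | ⟨h, h'⟩
      · exact .inl h
      · exact .inr ⟨h, by simpa using h'⟩)
    (fun y => mk y.level (y.coord.add (-1)))
    (fun y => by
      conv_rhs => rw [← mk_level_coord y]
      simp only [level_mk, coord_mk]
      congr 2
      ext; simp)

/-- The lift of `x ↦ q x`. -/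
noncomputable def dilation (q : ℚ) (hq : 0 < q) : LiftedLine ≃o LiftedLine :=
  StrictMono.orderIsoOfRightInverse (fun y => mk y.level (y.coord.mul q hq.ne'))
    (by
      intro y z h
      rw [← mk_level_coord y, ← mk_level_coord z, mk_lt_mk] at h
      rw [mk_lt_mk]
      rcases h with h | ⟨h, h'⟩
      · exact .inl h
      · refine .inr ⟨h, ?_⟩
        simpa using mul_lt_mul_of_pos_right h' (by exact_mod_cast hq : (0 : ℝ) < q))
    (fun y => mk y.level (y.coord.mul q⁻¹ (inv_ne_zero hq.ne')))
    (fun y => by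
      conv_rhs => rw [← mk_level_coord y]
      simp only [level_mk, coord_mk]
      congr 2
      ext
      have : (q : ℝ) ≠ 0 := by exact_mod_cast hq.ne'
      simp [this])

open Classical in
/-- The lift of `x ↦ -1/x` that moves every point upwards: negative points stay on their copy of
the affine line, and positive points pass the next lift of `∞`. -/
noncomputable def rotation : LiftedLine ≃o LiftedLine :=
  StrictMono.orderIsoOfRightInverse
    (fun y => mk (if y.coord.val < 0 then y.level else y.level + 1) y.coord.negInv)
    (by
      intro y z h
      rw [← mk_level_coord y, ← mk_level_coord z, mk_lt_mk] at h
      rw [mk_lt_mk]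
      simp only [ColouredReal.val_negInv, neg_lt_neg_iff]
      rcases y.coord.val_pos_or_neg with hy | hy <;> rcases z.coord.val_pos_or_neg with hz | hz
      · simp only [hy, hz, if_true]
        rcases h with h | ⟨h, h'⟩
        · exact .inl h
        · exact .inr ⟨h, (inv_lt_inv_of_neg hz hy).2 h'⟩
      · simp only [hy, hz.not_gt, if_true, if_false]
        left; rcases h with h | h <;> omega
      · simp only [hy.not_gt, hz, if_true, if_false]
        rcases h with h | ⟨h, h'⟩
        · rcases (Int.add_one_le_iff.2 h).lt_or_eq with h1 | h1
          · exact .inl h1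
          · exact .inr ⟨h1, (inv_lt_zero.2 hz).trans (inv_pos.2 hy)⟩
        · exact absurd (h'.trans hz) hy.not_gt
      · simp only [hy.not_gt, hz.not_gt, if_false]
        rcases h with h | ⟨h, h'⟩
        · exact .inl (by omega)
        · exact .inr ⟨by omega, (inv_lt_inv₀ hz hy).2 h'⟩)
    (fun y => mk (if y.coord.val < 0 then y.level - 1 else y.level) y.coord.negInv)
    (fun y => by
      rcases y.coord.val_pos_or_neg with hy | hy
      · have : ¬ -y.coord.val⁻¹ < 0 := by simpa using hy.le
        apply ext <;> simp [hy, this]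
      · have : -y.coord.val⁻¹ < 0 := by simpa using hy
        apply ext <;> simp [hy.not_gt, this])

-- `(rfl)` instead of `rfl` keeps these from being `dsimp` lemmas: definitional unfolding of
-- order isomorphisms is too expensive for the kernel.
@[simp] lemma level_translation (y) : (translation y).level = y.level := (rfl)
@[simp] lemma coord_translation (y) : (translation y).coord.val = y.coord.val + 1 :=
  (y.coord.val_add 1).trans (by simp)
@[simp] lemma level_dilation (q hq y) : (dilation q hq y).level = y.level := (rfl)
@[simp] lemma coord_dilation (q hq y) : (dilation q hq y).coord.val = y.coord.val * q := (rfl)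
open Classical in
@[simp] lemma level_rotation (y) :
    (rotation y).level = if y.coord.val < 0 then y.level else y.level + 1 := (rfl)
@[simp] lemma coord_rotation (y) : (rotation y).coord.val = -y.coord.val⁻¹ := (rfl)

lemma coord_translation_pow (n : ℕ) (y) :
    ((translation ^ n) y).coord.val = y.coord.val + n ∧ ((translation ^ n) y).level = y.level := by
  induction n with
  | zero => simp
  | succ n ih =>
    rw [pow_succ', RelIso.mul_apply]
    simp only [coord_translation, level_translation, ih.1, ih.2]
    exact ⟨by push_cast; ring, trivial⟩

lemma dilation_mul_translation (q : ℕ) (hq : (0 : ℚ) < q) :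
    dilation q hq * translation = translation ^ q * dilation q hq := by
  refine RelIso.ext fun y => ext ?_ ?_ <;> simp only [RelIso.mul_apply]
  · simp [(coord_translation_pow _ _).2]
  · simp [(coord_translation_pow _ _).1]; ring

lemma dilation_mul_rotation_mul_dilation (q : ℚ) (hq : 0 < q) :
    dilation q hq * rotation * dilation q hq = rotation := by
  have hq' : (0 : ℝ) < q := by exact_mod_cast hq
  refine RelIso.ext fun y => ext ?_ ?_ <;> simp only [RelIso.mul_apply]
  · simp [mul_neg_iff, hq', hq'.not_gt]
  · simp only [coord_dilation, coord_rotation, mul_inv_rev]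
    field_simp

/-- On the projective line both sides are `x ↦ x / (x + 1)`; the lifts agree as well. -/
lemma rotation_relation :
    rotation * translation⁻¹ * rotation = translation * rotation * translation := by
  refine RelIso.ext fun y => ?_
  obtain ⟨z, hy⟩ := translation.surjective (rotation y)
  simp only [RelIso.mul_apply]
  rw [← hy, RelIso.inv_apply_self]
  have hl := congrArg level hy.symm
  have hc := congrArg (fun y => (coord y).val) hy.symm
  simp only [level_rotation, coord_rotation, level_translation, coord_translation] at hl hc
  have hy0 := y.coord.val_ne_zero
  have hy1 := (translation y).coord.val_ne_zero
  rw [coord_translation] at hy1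
  have hc' : z.coord.val = -(y.coord.val + 1) / y.coord.val := by
    field_simp at hc ⊢; linarith
  apply ext
  · simp only [level_rotation, level_translation, coord_translation, ← hl]
    simp only [hc', div_neg_iff, neg_neg_iff_pos, neg_pos]
    rcases y.coord.val_pos_or_neg with h | h <;> rcases lt_or_gt_of_ne hy1 with h' | h'
    · simp only [h, h', h.not_gt, h'.not_gt, and_self, true_or, if_true]
    · simp only [h, h', h.not_gt, h'.not_gt, false_and, and_false, or_self, if_true, if_false]
    · linarith
    · simp only [h, h', h.not_gt, h'.not_gt, and_self, or_true, if_true, if_false]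
  · simp only [coord_rotation, coord_translation, hc']
    field_simp
    ring

/-- The group generated by `x ↦ x + 1`, `x ↦ -1/x`, `x ↦ 4x` and `x ↦ 9x`, lifted to the universal
cover of the projective line. -/
noncomputable def projectiveGroup : Subgroup (LiftedLine ≃o LiftedLine) :=
  Subgroup.closure {translation, rotation,
    dilation 2 (by norm_num) ^ 2, dilation 3 (by norm_num) ^ 2}

lemma projectiveGroup_le_commutator : projectiveGroup ≤ ⁅projectiveGroup, projectiveGroup⁆ :=
  closure_le_commutator_of_relations _ _ _ _
    (dilation_mul_translation 2 _) (dilation_mul_translation 3 _) rotation_relation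
    (dilation_mul_rotation_mul_dilation _ _) (dilation_mul_rotation_mul_dilation _ _)

lemma projectiveGroup_fg : projectiveGroup.FG :=
  (Subgroup.fg_iff _).2 ⟨_, rfl, by simp⟩

lemma projectiveGroup_le_colourAut : projectiveGroup ≤ colourAut colour := by
  have h : ∀ q hq, dilation q hq ∈ colourAut colour :=
    fun q hq y => ColouredReal.colour_mul _ _ hq.ne'
  rw [projectiveGroup, Subgroup.closure_le]
  rintro x (rfl | rfl | rfl | rfl)
  · exact fun y => ColouredReal.colour_add _ _
  · exact fun y => ColouredReal.colour_negInv _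
  · exact pow_mem (h _ _) 2
  · exact pow_mem (h _ _) 2

lemma translation_zpow (m : ℤ) (y) :
    ((translation ^ m) y).level = y.level ∧ ((translation ^ m) y).coord.val = y.coord.val + m := by
  obtain ⟨n, rfl | rfl⟩ := m.eq_nat_or_neg
  · simpa using (coord_translation_pow n y).symm
  · have h := coord_translation_pow n ((translation ^ (-(n : ℤ))) y)
    rw [← RelIso.mul_apply, ← zpow_natCast, ← zpow_add, add_neg_cancel, zpow_zero] at h
    refine ⟨h.2.symm, ?_⟩
    have := h.1
    rw [RelIso.one_apply] at this
    push_cast; linarith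

lemma dilation_sq_inv (y) :
    (((dilation 2 (by norm_num)) ^ 2)⁻¹ y).level = y.level ∧
    (((dilation 2 (by norm_num)) ^ 2)⁻¹ y).coord.val = y.coord.val / 4 := by
  have hinj := (dilation 2 (by norm_num) ^ 2).injective
  have e : (dilation 2 (by norm_num) ^ 2)⁻¹ y = mk y.level (y.coord.mul (1 / 4) (by norm_num)) := by
    apply hinj
    rw [RelIso.apply_inv_self, pow_two, RelIso.mul_apply]
    apply ext
    · rw [level_dilation, level_dilation, level_mk]
    · rw [coord_dilation, coord_dilation, coord_mk, ColouredReal.val_mul]; push_cast; ring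
  rw [e, level_mk, coord_mk, ColouredReal.val_mul]
  exact ⟨rfl, by push_cast; ring⟩

lemma dilation_sq_pow_inv (n : ℕ) (y) :
    ((((dilation 2 (by norm_num)) ^ 2) ^ n)⁻¹ y).level = y.level ∧
    ((((dilation 2 (by norm_num)) ^ 2) ^ n)⁻¹ y).coord.val = y.coord.val / 4 ^ n := by
  induction n generalizing y with
  | zero => simp
  | succ n ih =>
    rw [pow_succ, mul_inv_rev, RelIso.mul_apply, (dilation_sq_inv _).1, (dilation_sq_inv _).2,
      (ih y).1, (ih y).2]
    exact ⟨rfl, by rw [pow_succ]; field_simp⟩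

/-- Bounded parts of an affine line can be contracted into any open interval, by
`x ↦ 4⁻ʲ (4⁻ⁱ x + m)`. -/
lemma exists_contraction_affine (r a b : ℝ) (hab : a < b) :
    ∃ k ∈ projectiveGroup, ∀ y : LiftedLine, |y.coord.val| < r →
      (k y).level = y.level ∧ a < (k y).coord.val ∧ (k y).coord.val < b := by
  obtain ⟨i, hi⟩ := pow_unbounded_of_one_lt r (by norm_num : (1 : ℝ) < 4)
  obtain ⟨j, hj⟩ := pow_unbounded_of_one_lt (3 / (b - a)) (by norm_num : (1 : ℝ) < 4)
  rw [div_lt_iff₀ (sub_pos.2 hab)] at hj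
  set m : ℤ := ⌈4 ^ j * a⌉ + 1
  have hm1 : 4 ^ j * a + 1 ≤ m := by push_cast [m]; linarith [Int.le_ceil (4 ^ j * a)]
  have hm2 : (m : ℝ) < 4 ^ j * a + 2 := by push_cast [m]; linarith [Int.ceil_lt_add_one (4 ^ j * a)]
  have hd : dilation 2 (by norm_num) ^ 2 ∈ projectiveGroup := Subgroup.subset_closure (by simp)
  have ht : translation ∈ projectiveGroup := Subgroup.subset_closure (by simp)
  refine ⟨_, mul_mem (mul_mem (inv_mem (pow_mem hd j)) (zpow_mem ht m)) (inv_mem (pow_mem hd i)),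
    fun y hy => ?_⟩
  simp only [RelIso.mul_apply]
  rw [(dilation_sq_pow_inv _ _).1, (dilation_sq_pow_inv _ _).2, (translation_zpow _ _).1,
    (translation_zpow _ _).2, (dilation_sq_pow_inv _ _).1, (dilation_sq_pow_inv _ _).2]
  have h4i : (0 : ℝ) < 4 ^ i := by positivity
  have h4j : (0 : ℝ) < 4 ^ j := by positivity
  have h1 : |y.coord.val / 4 ^ i| < 1 := by
    rw [abs_div, abs_of_pos h4i, div_lt_one h4i]; exact hy.trans hi
  rw [abs_lt] at h1
  refine ⟨rfl, ?_, ?_⟩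
  · rw [lt_div_iff₀ h4j]; linarith
  · rw [div_lt_iff₀ h4j]; linarith

/-- The open interval of the lifted line between two consecutive lifts of `0`. It contains exactly
one lift of `∞`, the one between the levels `0` and `1`. -/
def chart : Set LiftedLine := {y | (rotation⁻¹ y).level = 0}

lemma mem_chart_iff {y : LiftedLine} :
    y ∈ chart ↔ y.level = 0 ∧ 0 < y.coord.val ∨ y.level = 1 ∧ y.coord.val < 0 := by
  obtain ⟨z, rfl⟩ := rotation.surjective y
  simp only [chart, Set.mem_ofPred_eq, RelIso.inv_apply_self, level_rotation, coord_rotation]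
  rcases z.coord.val_pos_or_neg with h | h
  · simp [h, h.not_gt]
  · simp [h, h.not_gt]

lemma level_mono {y z : LiftedLine} (h : y ≤ z) : y.level ≤ z.level :=
  Prod.Lex.monotone_fst _ _ h

lemma ordConnected_chart : chart.OrdConnected := ⟨fun y hy z hz x hx => by
  have h1 := level_mono ((OrderIso.le_iff_le rotation⁻¹).2 hx.1)
  have h2 := level_mono ((OrderIso.le_iff_le rotation⁻¹).2 hx.2)
  simp only [chart, Set.mem_ofPred_eq] at hy hz ⊢
  omega⟩

lemma coord_le_coord {y z : LiftedLine} (h : y ≤ z) (hl : y.level = z.level) :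
    y.coord.val ≤ z.coord.val := by
  by_contra! hc
  exact absurd (mk_lt_mk.2 (.inr ⟨hl.symm, hc⟩)) h.not_gt

lemma lt_translation (y) : y < translation y :=
  mk_lt_mk.2 (.inr ⟨rfl, (lt_add_one _).trans_eq (coord_translation y).symm⟩)

lemma translation_inv_lt (y) : translation⁻¹ y < y := by
  conv_rhs => rw [← RelIso.apply_inv_self translation y]
  exact lt_translation _

lemma chart_noMin : ∀ y ∈ chart, ∃ z ∈ chart, z < y := by
  intro y hy
  refine ⟨rotation (translation⁻¹ (rotation⁻¹ y)), ?_, ?_⟩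
  · change (rotation⁻¹ (rotation (translation⁻¹ (rotation⁻¹ y)))).level = 0
    rw [RelIso.inv_apply_self, ← level_translation, RelIso.apply_inv_self]
    exact hy
  · conv_rhs => rw [← RelIso.apply_inv_self rotation y]
    exact (OrderIso.lt_iff_lt _).2 (translation_inv_lt _)

lemma chart_noMax : ∀ y ∈ chart, ∃ z ∈ chart, y < z := by
  intro y hy
  refine ⟨rotation (translation (rotation⁻¹ y)), ?_, ?_⟩
  · change (rotation⁻¹ (rotation (translation (rotation⁻¹ y)))).level = 0
    rw [RelIso.inv_apply_self, level_translation]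
    exact hy
  · conv_lhs => rw [← RelIso.apply_inv_self rotation y]
    exact (OrderIso.lt_iff_lt _).2 (lt_translation _)

/-- The contraction on the affine line of level `0`, transported to `chart` by the rotation. -/
lemma exists_contraction {p q a b : LiftedLine} (hp : p ∈ chart) (hq : q ∈ chart)
    (ha : a ∈ chart) (hb : b ∈ chart) (hab : a < b) :
    ∃ k ∈ projectiveGroup, ∀ y, p ≤ y → y ≤ q → a < k y ∧ k y < b := by
  have hw : rotation ∈ projectiveGroup := Subgroup.subset_closure (by simp)
  have hab' : rotation⁻¹ a < rotation⁻¹ b := (OrderIso.lt_iff_lt rotation⁻¹).2 hab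
  have hlab : (rotation⁻¹ a).level = (rotation⁻¹ b).level := Eq.trans ha hb.symm
  have hab'' : (rotation⁻¹ a).coord.val < (rotation⁻¹ b).coord.val := by
    refine lt_of_le_of_ne (coord_le_coord hab'.le hlab) fun h => hab'.ne (ext hlab h)
  obtain ⟨k, hk, hkr⟩ := exists_contraction_affine
    (max |(rotation⁻¹ p).coord.val| |(rotation⁻¹ q).coord.val| + 1) _ _ hab''
  refine ⟨rotation * k * rotation⁻¹, mul_mem (mul_mem hw hk) (inv_mem hw), fun y hpy hyq => ?_⟩
  have hy := ordConnected_chart.out hp hq ⟨hpy, hyq⟩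
  have h1 := coord_le_coord ((OrderIso.le_iff_le rotation⁻¹).2 hpy) (Eq.trans hp hy.symm)
  have h2 := coord_le_coord ((OrderIso.le_iff_le rotation⁻¹).2 hyq) (Eq.trans hy hq.symm)
  obtain ⟨h3, h4, h5⟩ := hkr (rotation⁻¹ y) ((abs_le_max_abs_abs h1 h2).trans_lt (lt_add_one _))
  have e : ∀ z : LiftedLine, z = rotation (rotation⁻¹ z) := fun z =>
    (RelIso.apply_inv_self _ _).symm
  have hy0 : (rotation⁻¹ y).level = 0 := hy
  simp only [RelIso.mul_apply]
  constructor
  · conv_lhs => rw [e a]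
    refine (OrderIso.lt_iff_lt rotation).2 (mk_lt_mk.2 (.inr ⟨?_, h4⟩))
    exact (Eq.trans ha hy0.symm).trans h3.symm
  · conv_rhs => rw [e b]
    refine (OrderIso.lt_iff_lt rotation).2 (mk_lt_mk.2 (.inr ⟨?_, h5⟩))
    exact h3.trans (Eq.trans hy0 hb.symm)

end LiftedLine

/-! ### Periodic automorphisms -/

namespace ColourDense

lemma prodLex {L α : Type*} [LinearOrder L] [LinearOrder α] {κ : α → ℤ} (h : ColourDense κ)
    (f : L → ℤ) : ColourDense fun y : L ×ₗ α => f (ofLex y).1 + κ (ofLex y).2 where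
  between a b hab i := by
    rcases Prod.Lex.lt_iff.1 hab with h' | ⟨h', h''⟩
    · obtain ⟨c, hc, hci⟩ := h.above (ofLex a).2 (i - f (ofLex a).1)
      exact ⟨toLex ((ofLex a).1, c), Prod.Lex.lt_iff.2 (.inr ⟨rfl, hc⟩),
        Prod.Lex.lt_iff.2 (.inl h'), by simp [hci]⟩
    · obtain ⟨c, hc, hc', hci⟩ := h.between _ _ h'' (i - f (ofLex a).1)
      exact ⟨toLex ((ofLex a).1, c), Prod.Lex.lt_iff.2 (.inr ⟨rfl, hc⟩),
        Prod.Lex.lt_iff.2 (.inr ⟨h', hc'⟩), by simp [hci]⟩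
  above a i := by
    obtain ⟨c, hc, hci⟩ := h.above (ofLex a).2 (i - f (ofLex a).1)
    exact ⟨toLex ((ofLex a).1, c), Prod.Lex.lt_iff.2 (.inr ⟨rfl, hc⟩), by simp [hci]⟩
  below a i := by
    obtain ⟨c, hc, hci⟩ := h.below (ofLex a).2 (i - f (ofLex a).1)
    exact ⟨toLex ((ofLex a).1, c), Prod.Lex.lt_iff.2 (.inr ⟨rfl, hc⟩), by simp [hci]⟩

variable {α β ι : Type*} [LinearOrder α] [LinearOrder β]

lemma sumLex {κ : α → ι} {μ : β → ι} (hκ : ColourDense κ) (hμ : ColourDense μ) :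
    ColourDense fun z : α ⊕ₗ β => Sum.elim κ μ (ofLex z) where
  between a b hab i := by
    induction a using Lex.rec with | _ a => ?_
    induction b using Lex.rec with | _ b => ?_
    rcases a with a | a <;> rcases b with b | b
    · obtain ⟨c, h1, h2, h3⟩ := hκ.between a b (Sum.Lex.inl_lt_inl_iff.1 hab) i
      exact ⟨Sum.inlₗ c, Sum.Lex.inl_lt_inl_iff.2 h1, Sum.Lex.inl_lt_inl_iff.2 h2, h3⟩
    · obtain ⟨c, h1, h3⟩ := hκ.above a i
      exact ⟨Sum.inlₗ c, Sum.Lex.inl_lt_inl_iff.2 h1, Sum.Lex.inl_lt_inr _ _, h3⟩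
    · exact absurd hab Sum.Lex.not_inr_lt_inl
    · obtain ⟨c, h1, h2, h3⟩ := hμ.between a b (Sum.Lex.inr_lt_inr_iff.1 hab) i
      exact ⟨Sum.inrₗ c, Sum.Lex.inr_lt_inr_iff.2 h1, Sum.Lex.inr_lt_inr_iff.2 h2, h3⟩
  above a i := by
    induction a using Lex.rec with | _ a => ?_
    rcases a with a | a
    · obtain ⟨c, h1, h3⟩ := hκ.above a i
      exact ⟨Sum.inlₗ c, Sum.Lex.inl_lt_inl_iff.2 h1, h3⟩
    · obtain ⟨c, h1, h3⟩ := hμ.above a i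
      exact ⟨Sum.inrₗ c, Sum.Lex.inr_lt_inr_iff.2 h1, h3⟩
  below a i := by
    induction a using Lex.rec with | _ a => ?_
    rcases a with a | a
    · obtain ⟨c, h1, h3⟩ := hκ.below a i
      exact ⟨Sum.inlₗ c, Sum.Lex.inl_lt_inl_iff.2 h1, h3⟩
    · obtain ⟨c, h1, h3⟩ := hμ.below a i
      exact ⟨Sum.inrₗ c, Sum.Lex.inr_lt_inr_iff.2 h1, h3⟩

lemma subtype {κ : α → ι} (h : ColourDense κ) {s : Set α} (hs : s.OrdConnected)
    (hmax : ∀ x ∈ s, ∃ y ∈ s, x < y) (hmin : ∀ x ∈ s, ∃ y ∈ s, y < x) :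
    ColourDense fun x : s => κ x where
  between a b hab i := by
    obtain ⟨c, h1, h2, h3⟩ := h.between a b hab i
    exact ⟨⟨c, hs.out a.2 b.2 ⟨h1.le, h2.le⟩⟩, h1, h2, h3⟩
  above a i := by
    obtain ⟨b, hb, hab⟩ := hmax a a.2
    obtain ⟨c, h1, h2, h3⟩ := h.between a b hab i
    exact ⟨⟨c, hs.out a.2 hb ⟨h1.le, h2.le⟩⟩, h1, h3⟩
  below a i := by
    obtain ⟨b, hb, hab⟩ := hmin a a.2
    obtain ⟨c, h1, h2, h3⟩ := h.between b a hab i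
    exact ⟨⟨c, hs.out hb a.2 ⟨h1.le, h2.le⟩⟩, h2, h3⟩

end ColourDense

section Periodic

variable {X : Type*} [LinearOrder X]

/-- The translation `(n, x) ↦ (n + 1, x)` of the line `ℤ ×ₗ X`, whose quotient is a circle. -/
noncomputable def shift : ℤ ×ₗ X ≃o ℤ ×ₗ X :=
  Prod.Lex.prodLexCongr (OrderIso.addRight 1) (OrderIso.refl X)

lemma shift_apply (e : ℤ ×ₗ X) : shift e = toLex ((ofLex e).1 + 1, (ofLex e).2) := rfl

lemma shift_zpow_apply (n : ℤ) (e : ℤ ×ₗ X) :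
    (shift ^ n) e = toLex ((ofLex e).1 + n, (ofLex e).2) := by
  induction n using Int.induction_on generalizing e with
  | zero => simp
  | succ n ih =>
    rw [zpow_add_one, RelIso.mul_apply, ih, shift_apply, ofLex_toLex]
    simp only [add_assoc, add_comm (1 : ℤ)]
  | pred n ih =>
    have h : shift⁻¹ e = toLex ((ofLex e).1 - 1, (ofLex e).2) := by
      apply shift.injective
      rw [RelIso.apply_inv_self, shift_apply]
      simp
    rw [zpow_sub_one, RelIso.mul_apply, ih, h]
    simp only [ofLex_toLex]
    congr 2
    ring

/-- The colouring of `ℤ ×ₗ X` that is raised by `1` by the translation. -/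
def liftColour (κ : X → ℤ) (e : ℤ ×ₗ X) : ℤ := (ofLex e).1 + κ (ofLex e).2

/-- The fundamental domain for `shift` between a cut of `X` with lower part `low` and its
translate. -/
def fundamentalDomain (low : Set X) : Set (ℤ ×ₗ X) :=
  {e | (ofLex e).1 = 0 ∧ (ofLex e).2 ∉ low ∨ (ofLex e).1 = 1 ∧ (ofLex e).2 ∈ low}

lemma ordConnected_fundamentalDomain {low : Set X} (hlow : IsLowerSet low) :
    (fundamentalDomain low).OrdConnected := by
  refine ⟨fun a ha b hb e he => ?_⟩
  have h1 := Prod.Lex.le_iff'.1 he.1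
  have h2 := Prod.Lex.le_iff'.1 he.2
  have hle : (ofLex e).1 = 0 ∨ (ofLex e).1 = 1 := by
    rcases ha with ha | ha <;> rcases hb with hb | hb <;> omega
  rcases hle with h | h
  · rcases ha with ha | ha
    · exact .inl ⟨h, fun hel => ha.2 (hlow (h1.2 (ha.1.trans h.symm)) hel)⟩
    · omega
  · rcases hb with hb | hb
    · omega
    · exact .inr ⟨h, hlow (h2.2 (h.trans hb.1.symm)) hb.2⟩

/-- There are colour-preserving automorphisms commuting with the translation that take the cut
between the copies of `X` to the cut with lower part `low`, and take prescribed values at two given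
points. -/
lemma exists_periodic_automorphism [Countable X] {κ : X → ℤ} (hκ : ColourDense κ) {low : Set X}
    (hlow : IsLowerSet low) (hmax : ∀ x ∈ low, ∃ y ∈ low, x < y)
    (hmin : ∀ x ∉ low, ∃ y ∉ low, y < x) {p q p' q' : X} (hpq : p < q) (hp' : p' ∉ low)
    (hq' : q' ∈ low) (hp : κ p' = κ p) (hq : 1 + κ q' = κ q) :
    ∃ ρ : ℤ ×ₗ X ≃o ℤ ×ₗ X, Commute ρ shift ∧ ρ ∈ colourAut (liftColour κ) ∧
      ρ (toLex (0, p)) = toLex (0, p') ∧ ρ (toLex (0, q)) = toLex (1, q') := by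
  classical
  let Z := fundamentalDomain low
  have hZ : ColourDense fun e : Z => liftColour κ e := by
    refine (hκ.prodLex id).subtype (ordConnected_fundamentalDomain hlow) ?_ ?_
    · rintro e (⟨h, h'⟩ | ⟨h, h'⟩)
      · exact ⟨toLex (1, q'), .inr ⟨rfl, hq'⟩, Prod.Lex.lt_iff.2 (.inl (by simp [h]))⟩
      · obtain ⟨y, hy, hlt⟩ := hmax _ h'
        exact ⟨toLex (1, y), .inr ⟨rfl, hy⟩, Prod.Lex.lt_iff.2 (.inr ⟨h, hlt⟩)⟩
    · rintro e (⟨h, h'⟩ | ⟨h, h'⟩)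
      · obtain ⟨y, hy, hlt⟩ := hmin _ h'
        exact ⟨toLex (0, y), .inl ⟨rfl, hy⟩, Prod.Lex.lt_iff.2 (.inr ⟨h.symm, hlt⟩)⟩
      · exact ⟨toLex (0, p'), .inl ⟨rfl, hp'⟩, Prod.Lex.lt_iff.2 (.inl (by simp [h]))⟩
  let zp : Z := ⟨toLex (0, p'), .inl ⟨rfl, hp'⟩⟩
  let zq : Z := ⟨toLex (1, q'), .inr ⟨rfl, hq'⟩⟩
  have hz : zp < zq := Prod.Lex.lt_iff.2 (.inl Int.zero_lt_one)
  have : Nonempty X := ⟨p⟩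
  have : Nonempty Z := ⟨zp⟩
  have : Countable (ℤ ×ₗ X) := inferInstanceAs (Countable (ℤ × X))
  have hzp : liftColour κ zp = κ p := by simp [liftColour, zp, hp]
  have hzq : liftColour κ zq = κ q := by simp [liftColour, zq, hq]
  obtain ⟨ψ, hψc, hψ⟩ := ColouredPartialIso.exists_orderIso hκ hZ ⟨{(p, zp), (q, zq)}, by
    constructor
    · simp only [Finset.mem_insert, Finset.mem_singleton]
      rintro _ (rfl | rfl) _ (rfl | rfl) <;> simp [hpq, hz, hpq.not_gt, hz.not_gt]
    · simp only [Finset.mem_insert, Finset.mem_singleton]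
      rintro _ (rfl | rfl)
      · exact hzp
      · exact hzq⟩
  have hψp := hψ (p, zp) (by simp)
  have hψq := hψ (q, zq) (by simp)
  -- the fundamental domain lies below its translate
  have hcut : ∀ y z : Z, (y : ℤ ×ₗ X) < shift z := by
    rintro ⟨y, hy⟩ ⟨z, hz⟩
    rw [Prod.Lex.lt_iff, shift_apply, ofLex_toLex]
    rcases hy with ⟨hy, hy'⟩ | ⟨hy, hy'⟩ <;> rcases hz with ⟨hz, hz'⟩ | ⟨hz, hz'⟩
    · left; simp [hy, hz]
    · left; simp [hy, hz]
    · right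
      refine ⟨by simp [hy, hz], not_le.1 fun h => hz' (hlow h hy')⟩
    · left; simp [hy, hz]
  let F : ℤ ×ₗ X → ℤ ×ₗ X := fun e => (shift ^ (ofLex e).1) (ψ (ofLex e).2 : ℤ ×ₗ X)
  have hshift_mono : ∀ (e : ℤ ×ₗ X) (m n : ℤ), m ≤ n → (shift ^ m) e ≤ (shift ^ n) e := by
    intro e m n h
    rw [shift_zpow_apply, shift_zpow_apply, Prod.Lex.le_iff']
    exact ⟨by simpa using h, fun _ => le_rfl⟩
  have hF : StrictMono F := by
    intro e e' h
    rcases Prod.Lex.lt_iff.1 h with h | ⟨h, h'⟩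
    · calc F e < (shift ^ (ofLex e).1) (shift (ψ (ofLex e').2 : ℤ ×ₗ X)) :=
            (OrderIso.lt_iff_lt _).2 (hcut _ _)
        _ = (shift ^ ((ofLex e).1 + 1)) (ψ (ofLex e').2 : ℤ ×ₗ X) := by
            rw [zpow_add_one, RelIso.mul_apply]
        _ ≤ F e' := hshift_mono _ _ _ (Int.add_one_le_iff.2 h)
    · change (shift ^ (ofLex e).1) _ < (shift ^ (ofLex e').1) _
      rw [h]
      exact (OrderIso.lt_iff_lt _).2 (ψ.strictMono h')
  have hFs : Function.Surjective F := by
    intro e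
    have key : ∃ n : ℤ, (shift ^ n) e ∈ Z := by
      by_cases h : (ofLex e).2 ∈ low
      · exact ⟨1 - (ofLex e).1, .inr (by rw [shift_zpow_apply]; simpa using h)⟩
      · exact ⟨-(ofLex e).1, .inl (by rw [shift_zpow_apply]; simpa using h)⟩
    obtain ⟨n, hn⟩ := key
    refine ⟨toLex (-n, ψ.symm ⟨_, hn⟩), ?_⟩
    change (shift ^ (-n)) (ψ (ψ.symm ⟨_, hn⟩) : ℤ ×ₗ X) = e
    rw [OrderIso.apply_symm_apply, ← RelIso.mul_apply, ← zpow_add, neg_add_cancel, zpow_zero,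
      RelIso.one_apply]
  refine ⟨hF.orderIsoOfSurjective F hFs, ?_, fun e => ?_, ?_, ?_⟩
  · refine RelIso.ext fun e => ?_
    change (shift ^ ((ofLex e).1 + 1)) (ψ (ofLex e).2 : ℤ ×ₗ X) =
      shift ((shift ^ (ofLex e).1) (ψ (ofLex e).2 : ℤ ×ₗ X))
    rw [add_comm, zpow_add, zpow_one, RelIso.mul_apply]
  · change liftColour κ ((shift ^ (ofLex e).1) (ψ (ofLex e).2 : ℤ ×ₗ X)) = _
    have h := hψc (ofLex e).2
    rw [shift_zpow_apply]
    simp only [liftColour, ofLex_toLex] at h ⊢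
    omega
  · change (shift ^ (0 : ℤ)) (ψ p : ℤ ×ₗ X) = _
    rw [hψp]; rfl
  · change (shift ^ (0 : ℤ)) (ψ q : ℤ ×ₗ X) = _
    rw [hψq]; rfl

end Periodic

/-! ### Groups commuting with a translation of a line -/

section Dynamics

variable {E : Type*} [LinearOrder E] {T : E ≃o E}

lemma map_zpow_of_commute {g : E ≃o E} (hg : Commute g T) (n : ℤ) (x : E) :
    g ((T ^ n) x) = (T ^ n) (g x) := by
  rw [← RelIso.mul_apply, (hg.zpow_right n).eq, RelIso.mul_apply]

lemma zpow_zpow_apply (T : E ≃o E) (m n : ℤ) (x : E) : (T ^ m) ((T ^ n) x) = (T ^ (m + n)) x := by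
  rw [← RelIso.mul_apply, ← zpow_add]

lemma commute_of_disjoint_support {g h : E ≃o E} {A B : Set E} (hAB : Disjoint A B)
    (hg : ∀ x ∉ A, g x = x) (hh : ∀ x ∉ B, h x = x) : Commute g h := by
  have stable : ∀ {k : E ≃o E} {S : Set E}, (∀ x ∉ S, k x = x) → ∀ x ∈ S, k x ∈ S := by
    intro k S hk x hx
    by_contra hkx
    exact hkx ((k.injective (hk _ hkx)).symm ▸ hx)
  refine RelIso.ext fun x => ?_
  rw [RelIso.mul_apply, RelIso.mul_apply]
  by_cases hA : x ∈ A
  · rw [hh x (hAB.notMem_of_mem_left hA),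
      hh _ (hAB.notMem_of_mem_left (stable hg x hA))]
  · by_cases hB : x ∈ B
    · rw [hg x hA, hg _ (hAB.notMem_of_mem_right (stable hh x hB))]
    · rw [hg x hA, hh x hB, hg x hA]

/-- A degree for a translation `T` of a line: a monotone integer-valued function that `T` raises
by one. It makes `T` fixed-point free and the line archimedean with respect to `T`. -/
structure IsDegree (T : E ≃o E) (deg : E → ℤ) : Prop where
  monotone : Monotone deg
  map_translation : ∀ x, deg (T x) = deg x + 1

namespace IsDegree

variable {deg : E → ℤ}

lemma map_zpow (hd : IsDegree T deg) (n : ℤ) (x : E) : deg ((T ^ n) x) = deg x + n := by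
  induction n using Int.induction_on generalizing x with
  | zero => simp
  | succ n ih => rw [zpow_add_one, RelIso.mul_apply, ih, hd.map_translation]; ring
  | pred n ih =>
    have h := hd.map_translation (T⁻¹ x)
    rw [RelIso.apply_inv_self] at h
    rw [zpow_sub_one, RelIso.mul_apply, ih]; omega

lemma lt_of_deg_lt (hd : IsDegree T deg) {x y : E} (h : deg x < deg y) : x < y :=
  not_le.1 fun h' => (hd.monotone h').not_gt h

lemma zpow_le_zpow (hd : IsDegree T deg) {m n : ℤ} (h : m ≤ n) (x : E) :
    (T ^ m) x ≤ (T ^ n) x := by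
  rcases h.lt_or_eq with h | rfl
  · exact (hd.lt_of_deg_lt (by rw [hd.map_zpow, hd.map_zpow]; omega)).le
  · exact le_rfl

lemma exists_zpow_le_lt (hd : IsDegree T deg) (p x : E) :
    ∃ n : ℤ, (T ^ n) p ≤ x ∧ x < (T ^ (n + 1)) p := by
  have h1 : (T ^ (deg x - deg p - 1)) p < x := hd.lt_of_deg_lt (by rw [hd.map_zpow]; omega)
  obtain ⟨n, hn, hmax⟩ := Int.exists_greatest_of_bdd (P := fun n => (T ^ n) p ≤ x)
    ⟨deg x - deg p, fun n hn => by
      have := hd.monotone hn; rw [hd.map_zpow] at this; omega⟩ ⟨_, h1.le⟩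
  exact ⟨n, hn, not_le.1 fun h => by have := hmax _ h; omega⟩

/-- Every point is brought into the fundamental domain `[p, T p)` by a power of `T`. -/
lemma exists_zpow_mem (hd : IsDegree T deg) (p x : E) :
    ∃ n : ℤ, p ≤ (T ^ n) x ∧ (T ^ n) x < T p := by
  obtain ⟨n, h1, h2⟩ := hd.exists_zpow_le_lt p x
  refine ⟨-n, ?_, ?_⟩
  · have := (OrderIso.le_iff_le (T ^ (-n))).2 h1
    rwa [zpow_zpow_apply, neg_add_cancel, zpow_zero] at this
  · have := (OrderIso.lt_iff_lt (T ^ (-n))).2 h2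
    rwa [zpow_zpow_apply, neg_add_cancel_left, zpow_one] at this

/-- A nontrivial colour-preserving automorphism commuting with `T` moves some interval off all its
translates: it cannot agree with a power of `T` at any point it moves, as `T` changes colours. -/
lemma exists_wandering [DenselyOrdered E] [NoMinOrder E] [NoMaxOrder E]
    (hd : IsDegree T deg) {c : E → ℤ} (hc : ∀ x, c (T x) = c x + 1) {f : E ≃o E}
    (hfc : f ∈ colourAut c) (hf1 : f ≠ 1) :
    ∃ a b, a < b ∧ ∀ x ∈ Set.Ioo a b, ∀ n : ℤ, (T ^ n) (f x) ∉ Set.Ioo a b := by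
  obtain ⟨x, hx⟩ : ∃ x, f x ≠ x := by
    by_contra! h
    exact hf1 (RelIso.ext h)
  obtain ⟨n, hn1, hn2⟩ := hd.exists_zpow_le_lt x (f x)
  have hcT : ∀ (n : ℤ) x, c ((T ^ n) x) = c x + n := by
    intro n x
    induction n using Int.induction_on generalizing x with
    | zero => simp
    | succ n ih => rw [zpow_add_one, RelIso.mul_apply, ih, hc]; ring
    | pred n ih =>
      have h := hc (T⁻¹ x)
      rw [RelIso.apply_inv_self] at h
      rw [zpow_sub_one, RelIso.mul_apply, ih]; omega
  have hn1' : (T ^ n) x < f x := by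
    refine lt_of_le_of_ne hn1 fun h => hx ?_
    have h' := hcT n x
    rw [h, hfc x] at h'
    have : n = 0 := by omega
    rw [← h, this, zpow_zero, RelIso.one_apply]
  set F := T ^ (-n) * f with hF
  have hF1 : x < F x := by
    have := (OrderIso.lt_iff_lt (T ^ (-n))).2 hn1'
    rwa [zpow_zpow_apply, neg_add_cancel, zpow_zero] at this
  have hF2 : F x < T x := by
    have := (OrderIso.lt_iff_lt (T ^ (-n))).2 hn2
    rwa [zpow_zpow_apply, neg_add_cancel_left, zpow_one] at this
  obtain ⟨u, hu1, hu2⟩ := exists_between hF1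
  obtain ⟨v, hv1, hv2⟩ := exists_between hF2
  have hux : F⁻¹ u < x := by
    have := (OrderIso.lt_iff_lt F⁻¹).2 hu2
    rwa [RelIso.inv_apply_self] at this
  have hvx : T⁻¹ v < x := by
    have := (OrderIso.lt_iff_lt T⁻¹).2 hv2
    rwa [RelIso.inv_apply_self] at this
  have hxv : x < F⁻¹ v := by
    have := (OrderIso.lt_iff_lt F⁻¹).2 hv1
    rwa [RelIso.inv_apply_self] at this
  obtain ⟨a, ha, hax⟩ := exists_between (max_lt hux hvx)
  obtain ⟨b, hxb, hb⟩ := exists_between (lt_min hu1 hxv)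
  rw [max_lt_iff] at ha
  rw [lt_min_iff] at hb
  refine ⟨a, b, hax.trans hxb, fun y hy m hm => ?_⟩
  have hy1 : u < F y := by
    have := (OrderIso.lt_iff_lt F).2 (ha.1.trans hy.1)
    rwa [RelIso.apply_inv_self] at this
  have hy2 : F y < v := by
    have := (OrderIso.lt_iff_lt F).2 (hy.2.trans hb.2)
    rwa [RelIso.apply_inv_self] at this
  have e : (T ^ m) (f y) = (T ^ (m + n)) (F y) := by
    rw [hF, RelIso.mul_apply, zpow_zpow_apply, add_neg_cancel_right]
  rw [e] at hm
  rcases le_or_gt 0 (m + n) with h | h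
  · have := hd.zpow_le_zpow h (F y)
    rw [zpow_zero, RelIso.one_apply] at this
    exact (hy1.trans_le this).not_gt (hm.2.trans hb.1)
  · have h1 := hd.zpow_le_zpow (show m + n ≤ -1 by omega) (F y)
    rw [zpow_neg_one] at h1
    have h2 := (OrderIso.lt_iff_lt T⁻¹).2 hy2
    exact (h1.trans_lt (h2.trans ha.2)).not_gt hm.1

end IsDegree

/-- Higman's commutator argument. Let `Γ` be generated by perfect subgroups whose supports `Γ`
compresses into the translates of any interval. Then a subgroup normalized by `Γ` that contains a
nontrivial element of `Γ` contains `Γ`. -/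
lemma le_of_normalized [DenselyOrdered E] [NoMinOrder E] [NoMaxOrder E] {deg c : E → ℤ}
    (hd : IsDegree T deg) (hc : ∀ x, c (T x) = c x + 1) {Γ N : Subgroup (E ≃o E)}
    (hΓT : ∀ g ∈ Γ, Commute g T) (hΓc : Γ ≤ colourAut c) {ι : Type*}
    (K : ι → Subgroup (E ≃o E)) (U : ι → Set E) (hΓK : Γ = ⨆ i, K i)
    (hK : ∀ i, K i ≤ ⁅K i, K i⁆) (hU : ∀ i, ∀ k ∈ K i, ∀ x ∉ U i, k x = x)
    (hcomp : ∀ i a b, a < b → ∃ g ∈ Γ, ∀ x ∈ U i, ∃ n : ℤ, (T ^ n) (g x) ∈ Set.Ioo a b)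
    (hN : ∀ g ∈ Γ, ∀ f ∈ N, g * f * g⁻¹ ∈ N) {f : E ≃o E} (hfN : f ∈ N) (hfΓ : f ∈ Γ)
    (hf1 : f ≠ 1) : Γ ≤ N := by
  obtain ⟨a, b, hab, hW⟩ := hd.exists_wandering hc (hΓc hfΓ) hf1
  let W : Set E := {x | ∃ n : ℤ, (T ^ n) x ∈ Set.Ioo a b}
  have hWf : Disjoint W {x | f⁻¹ x ∈ W} := by
    rw [Set.disjoint_left]
    rintro x ⟨n, hn⟩ ⟨m, hm⟩
    refine hW _ hm (n - m) ?_
    rw [map_zpow_of_commute (hΓT f hfΓ), RelIso.apply_inv_self, zpow_zpow_apply,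
      sub_add_cancel]
    exact hn
  -- commutators of elements supported in `W` lie in `N`
  have key : ∀ g ∈ Γ, ∀ h ∈ Γ, (∀ x ∉ W, g x = x) → (∀ x ∉ W, h x = x) →
      g * h * g⁻¹ * h⁻¹ ∈ N := by
    intro g hg h hh hgW hhW
    set u := f * g⁻¹ * f⁻¹ with hu
    have huW : ∀ x ∉ {x | f⁻¹ x ∈ W}, u x = x := by
      intro x hx
      have h1 : g⁻¹ (f⁻¹ x) = f⁻¹ x := by
        apply g.injective
        rw [RelIso.apply_inv_self, hgW _ hx]
      rw [hu, RelIso.mul_apply, RelIso.mul_apply, h1, RelIso.apply_inv_self]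
    have hcomm : Commute h u := commute_of_disjoint_support hWf hhW huW
    have hguN : g * u ∈ N := by
      have := mul_mem (hN g hg f hfN) (inv_mem hfN)
      rwa [show g * f * g⁻¹ * f⁻¹ = g * u by rw [hu]; group] at this
    have h2 : g * h * g⁻¹ * h⁻¹ = (g * u) * (h * (g * u)⁻¹ * h⁻¹) := by
      have : g * u * (h * (g * u)⁻¹ * h⁻¹) = g * (u * h * u⁻¹) * g⁻¹ * h⁻¹ := by group
      rw [this, ← hcomm.eq]; group
    rw [h2]
    exact mul_mem hguN (hN h hh _ (inv_mem hguN))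
  rw [hΓK, iSup_le_iff]
  intro i
  have hKΓ : K i ≤ Γ := hΓK ▸ le_iSup K i
  refine (hK i).trans (Subgroup.commutator_le.2 fun k₁ h₁ k₂ h₂ => ?_)
  obtain ⟨g, hg, hgU⟩ := hcomp i a b hab
  have hsupp : ∀ k ∈ K i, ∀ x ∉ W, (g * k * g⁻¹) x = x := by
    intro k hk x hx
    have h1 : g⁻¹ x ∉ U i := fun h => hx (by
      have := hgU _ h
      rwa [RelIso.apply_inv_self] at this)
    rw [RelIso.mul_apply, RelIso.mul_apply, hU i k hk _ h1, RelIso.apply_inv_self]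
  have hconj : ∀ k ∈ K i, g * k * g⁻¹ ∈ Γ := fun k hk =>
    mul_mem (mul_mem hg (hKΓ hk)) (inv_mem hg)
  have h3 := hN g⁻¹ (inv_mem hg) _
    (key _ (hconj k₁ h₁) _ (hconj k₂ h₂) (hsupp k₁ h₁) (hsupp k₂ h₂))
  have h4 : g⁻¹ * (g * k₁ * g⁻¹ * (g * k₂ * g⁻¹) * (g * k₁ * g⁻¹)⁻¹ * (g * k₂ * g⁻¹)⁻¹) * g⁻¹⁻¹ =
      k₁ * k₂ * k₁⁻¹ * k₂⁻¹ := by group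
  rw [h4] at h3
  exact h3

lemma isSimpleGroup_of_le_of_normalized {A : Type*} [Group A] {Γ : Subgroup A} (hne : Γ ≠ ⊥)
    (h : ∀ N : Subgroup A, (∀ g ∈ Γ, ∀ f ∈ N, g * f * g⁻¹ ∈ N) →
      ∀ f ∈ N, f ∈ Γ → f ≠ 1 → Γ ≤ N) : IsSimpleGroup Γ := by
  have := (Subgroup.nontrivial_iff_ne_bot Γ).2 hne
  refine ⟨fun N hN => or_iff_not_imp_left.2 fun hNne => ?_⟩
  obtain ⟨f, hf⟩ := (Subgroup.ne_bot_iff_exists_ne_one).1 hNne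
  have hle := h (N.map Γ.subtype)
    (by
      rintro g hg _ ⟨x, hx, rfl⟩
      exact ⟨_, hN.conj_mem x hx ⟨g, hg⟩, rfl⟩)
    f.1 (Subgroup.mem_map_of_mem _ f.2) f.1.2 (fun e => hf (Subtype.ext (Subtype.ext e)))
  refine eq_top_iff.2 fun x _ => ?_
  obtain ⟨y, hy, hyx⟩ := hle x.2
  rwa [← Subtype.ext hyx]

/-- Two groups `K₁`, `K₂` of periodic automorphisms of a line and two arcs `P₁`, `P₂` whose
compact parts `[p, q]`, `[q, T p]` cover the circle and can be contracted into any interval of the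
same arc by the group with the same index. -/
structure CoveringContraction (T : E ≃o E) (K₁ K₂ : Subgroup (E ≃o E)) (P₁ P₂ : Set E)
    (p q : E) : Prop where
  commute₁ : ∀ k ∈ K₁, Commute k T
  commute₂ : ∀ k ∈ K₂, Commute k T
  ordConnected₁ : P₁.OrdConnected
  ordConnected₂ : P₂.OrdConnected
  noMin₁ : ∀ x ∈ P₁, ∃ y ∈ P₁, y < x
  noMax₁ : ∀ x ∈ P₁, ∃ y ∈ P₁, x < y
  noMin₂ : ∀ x ∈ P₂, ∃ y ∈ P₂, y < x
  noMax₂ : ∀ x ∈ P₂, ∃ y ∈ P₂, x < y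
  lt₁ : p < q
  lt₂ : q < T p
  mem_p : p ∈ P₁
  mem_q : q ∈ P₁
  mem_q' : q ∈ P₂
  mem_Tp : T p ∈ P₂
  contract₁ : ∀ a ∈ P₁, ∀ b ∈ P₁, a < b → ∃ k ∈ K₁, ∀ y ∈ Set.Icc p q, k y ∈ Set.Ioo a b
  contract₂ : ∀ a ∈ P₂, ∀ b ∈ P₂, a < b → ∃ k ∈ K₂, ∀ y ∈ Set.Icc q (T p), k y ∈ Set.Ioo a b

lemma exists_left_mem {P : Set E} (hP : P.OrdConnected) (h : ∀ x ∈ P, ∃ y ∈ P, y < x) {a x : E}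
    (hx : x ∈ P) (ha : a < x) : ∃ a' ∈ P, a ≤ a' ∧ a' < x := by
  obtain ⟨y, hy, hyx⟩ := h x hx
  rcases le_total a y with h' | h'
  · exact ⟨y, hy, h', hyx⟩
  · exact ⟨a, hP.out hy hx ⟨h', ha.le⟩, le_rfl, ha⟩

lemma exists_right_mem {P : Set E} (hP : P.OrdConnected) (h : ∀ x ∈ P, ∃ y ∈ P, x < y) {b x : E}
    (hx : x ∈ P) (hb : x < b) : ∃ b' ∈ P, x < b' ∧ b' ≤ b := by
  obtain ⟨y, hy, hyx⟩ := h x hx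
  rcases le_total y b with h' | h'
  · exact ⟨y, hy, hyx, h'⟩
  · exact ⟨b, hP.out hx hy ⟨hb.le, h'⟩, hb, le_rfl⟩

namespace CoveringContraction

variable {K₁ K₂ : Subgroup (E ≃o E)} {P₁ P₂ : Set E} {p q : E}

lemma commute (H : CoveringContraction T K₁ K₂ P₁ P₂ p q) : ∀ k ∈ K₁ ⊔ K₂, Commute k T := by
  have : K₁ ⊔ K₂ ≤ Subgroup.centralizer {T} := sup_le
    (fun k hk => Subgroup.mem_centralizer_singleton_iff.2 (H.commute₁ k hk).eq)
    (fun k hk => Subgroup.mem_centralizer_singleton_iff.2 (H.commute₂ k hk).eq)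
  exact fun k hk => Subgroup.mem_centralizer_singleton_iff.1 (this hk)

/-- Both arcs `[p, q]` and `[q, T p]` can be compressed into the translates of any interval. -/
lemma exists_compress (H : CoveringContraction T K₁ K₂ P₁ P₂ p q) [DenselyOrdered E]
    {deg : E → ℤ} (hd : IsDegree T deg) {a b : E} (hab : a < b) :
    (∃ g ∈ K₁ ⊔ K₂, ∃ n : ℤ, ∀ y ∈ Set.Icc p q, (T ^ n) (g y) ∈ Set.Ioo a b) ∧
    (∃ g ∈ K₁ ⊔ K₂, ∃ n : ℤ, ∀ y ∈ Set.Icc q (T p), (T ^ n) (g y) ∈ Set.Ioo a b) := by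
  obtain ⟨x, hax, hxb⟩ := exists_between hab
  obtain ⟨n, hn1, hn2⟩ := hd.exists_zpow_mem p x
  have hax' : (T ^ n) a < (T ^ n) x := (OrderIso.lt_iff_lt _).2 hax
  have hxb' : (T ^ n) x < (T ^ n) b := (OrderIso.lt_iff_lt _).2 hxb
  have back : ∀ {a' b' z : E}, (T ^ n) a ≤ a' → b' ≤ (T ^ n) b → z ∈ Set.Ioo a' b' →
      (T ^ (-n)) z ∈ Set.Ioo a b := by
    intro a' b' z h1 h2 hz
    have h3 := (OrderIso.lt_iff_lt (T ^ (-n))).2 (h1.trans_lt hz.1)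
    have h4 := (OrderIso.lt_iff_lt (T ^ (-n))).2 (hz.2.trans_le h2)
    rw [zpow_zpow_apply, neg_add_cancel, zpow_zero] at h3 h4
    exact ⟨h3, h4⟩
  obtain ⟨a₂, ha₂, hpa₂, ha₂q⟩ := exists_left_mem H.ordConnected₂ H.noMin₂ H.mem_q' H.lt₁
  obtain ⟨b₁, hb₁, hqb₁, hb₁T⟩ := exists_right_mem H.ordConnected₁ H.noMax₁ H.mem_q H.lt₂
  obtain ⟨k, hk, hk'⟩ := H.contract₁ q H.mem_q b₁ hb₁ hqb₁
  obtain ⟨m, hm, hm'⟩ := H.contract₂ a₂ ha₂ q H.mem_q' ha₂q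
  have inl : ∀ {g}, g ∈ K₁ → g ∈ K₁ ⊔ K₂ := fun h => Subgroup.mem_sup_left h
  have inr : ∀ {g}, g ∈ K₂ → g ∈ K₁ ⊔ K₂ := fun h => Subgroup.mem_sup_right h
  rcases le_or_gt ((T ^ n) x) q with hxq | hxq
  · have hxP := H.ordConnected₁.out H.mem_p H.mem_q ⟨hn1, hxq⟩
    obtain ⟨a', ha', haa', ha'x⟩ := exists_left_mem H.ordConnected₁ H.noMin₁ hxP hax'
    obtain ⟨b', hb', hxb'', hbb'⟩ := exists_right_mem H.ordConnected₁ H.noMax₁ hxP hxb'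
    obtain ⟨g, hg, hg'⟩ := H.contract₁ a' ha' b' hb' (ha'x.trans hxb'')
    refine ⟨⟨g, inl hg, -n, fun y hy => back haa' hbb' (hg' y hy)⟩,
      ⟨g * m, mul_mem (inl hg) (inr hm), -n, fun y hy => back haa' hbb' (hg' _ ?_)⟩⟩
    have := hm' y hy
    exact ⟨hpa₂.trans this.1.le, this.2.le⟩
  · have hxP := H.ordConnected₂.out H.mem_q' H.mem_Tp ⟨hxq.le, hn2.le⟩
    obtain ⟨a', ha', haa', ha'x⟩ := exists_left_mem H.ordConnected₂ H.noMin₂ hxP hax'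
    obtain ⟨b', hb', hxb'', hbb'⟩ := exists_right_mem H.ordConnected₂ H.noMax₂ hxP hxb'
    obtain ⟨g, hg, hg'⟩ := H.contract₂ a' ha' b' hb' (ha'x.trans hxb'')
    refine ⟨⟨g * k, mul_mem (inr hg) (inl hk), -n, fun y hy => back haa' hbb' (hg' _ ?_)⟩,
      ⟨g, inr hg, -n, fun y hy => back haa' hbb' (hg' y hy)⟩⟩
    have := hk' y hy
    exact ⟨this.1.le, this.2.le.trans hb₁T⟩

/-- A set whose translates miss some interval can be compressed into the translates of any
interval. -/
lemma exists_compress_set (H : CoveringContraction T K₁ K₂ P₁ P₂ p q) [DenselyOrdered E]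
    {deg : E → ℤ} (hd : IsDegree T deg) {U : Set E} {v w : E} (hvw : v < w)
    (hU : ∀ x ∈ U, ∀ n : ℤ, (T ^ n) x ∉ Set.Ioo v w) {a b : E} (hab : a < b) :
    ∃ g ∈ K₁ ⊔ K₂, ∀ x ∈ U, ∃ n : ℤ, (T ^ n) (g x) ∈ Set.Ioo a b := by
  obtain ⟨m, hm, i, hm'⟩ := (H.exists_compress hd hvw).2
  obtain ⟨k, hk, j, hk'⟩ := (H.exists_compress hd hab).1
  refine ⟨k * m⁻¹, mul_mem hk (inv_mem hm), fun x hx => ?_⟩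
  obtain ⟨n, hn1, hn2⟩ := hd.exists_zpow_mem p (m⁻¹ x)
  rcases le_or_gt ((T ^ n) (m⁻¹ x)) q with h | h
  · refine ⟨j + n, ?_⟩
    have := hk' _ ⟨hn1, h⟩
    rwa [map_zpow_of_commute (H.commute k hk), zpow_zpow_apply] at this
  · have := hm' _ ⟨h.le, hn2.le⟩
    rw [map_zpow_of_commute (H.commute m hm), RelIso.apply_inv_self, zpow_zpow_apply] at this
    exact absurd this (hU x hx _)

/-- Some element moves a point beyond its translate. -/
lemma exists_translation_lt (H : CoveringContraction T K₁ K₂ P₁ P₂ p q) :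
    ∃ g ∈ K₁ ⊔ K₂, T p < g p := by
  obtain ⟨b₁, hb₁, hqb₁, hb₁T⟩ := exists_right_mem H.ordConnected₁ H.noMax₁ H.mem_q H.lt₂
  obtain ⟨k, hk, hk'⟩ := H.contract₁ q H.mem_q b₁ hb₁ hqb₁
  obtain ⟨b₂, hb₂, hb₂'⟩ := H.noMax₂ _ H.mem_Tp
  obtain ⟨m, hm, hm'⟩ := H.contract₂ _ H.mem_Tp b₂ hb₂ hb₂'
  have h1 := hk' p ⟨le_rfl, H.lt₁.le⟩
  exact ⟨m * k, mul_mem (Subgroup.mem_sup_right hm) (Subgroup.mem_sup_left hk),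
    (hm' _ ⟨h1.1.le, h1.2.le.trans hb₁T⟩).1⟩

end CoveringContraction

/-! ### The translation quasimorphism -/

lemma IsDegree.quasimorphism {deg : E → ℤ} (hd : IsDegree T deg) {g : E ≃o E}
    (hg : Commute g T) (x y : E) : |(deg (g y) - deg (g x)) - (deg y - deg x)| ≤ 1 := by
  have h1 : (T ^ (deg y - deg x - 1)) x < y := hd.lt_of_deg_lt (by rw [hd.map_zpow]; omega)
  have h2 : y < (T ^ (deg y - deg x + 1)) x := hd.lt_of_deg_lt (by rw [hd.map_zpow]; omega)
  have h3 := hd.monotone ((OrderIso.lt_iff_lt g).2 h1).le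
  have h4 := hd.monotone ((OrderIso.lt_iff_lt g).2 h2).le
  rw [map_zpow_of_commute hg, hd.map_zpow] at h3 h4
  rw [abs_le]
  omega

end Dynamics

/-- A quasimorphism of defect `1` is bounded by `6 k` on products of `k` commutators. -/
lemma abs_le_of_isProductOfCommutators {G : Type*} [Group G] (φ : G → ℤ) (h1 : φ 1 = 0)
    (hφ : ∀ g h, |φ (g * h) - φ g - φ h| ≤ 1) {k : ℕ} {g : G}
    (hg : IsProductOfCommutators k g) : |φ g| ≤ 6 * k := by
  obtain ⟨l, rfl, hl, rfl⟩ := hg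
  induction l with
  | nil => simp [h1]
  | cons x l ih =>
    have ih := ih fun y hy => hl y (List.mem_cons_of_mem _ hy)
    obtain ⟨a, b, rfl⟩ := hl x List.mem_cons_self
    have e1 := hφ (a * b * a⁻¹) b⁻¹
    have e2 := hφ (a * b) a⁻¹
    have e3 := hφ a b
    have e4 := hφ a a⁻¹
    have e5 := hφ b b⁻¹
    have e6 := hφ (a * b * a⁻¹ * b⁻¹) l.prod
    rw [mul_inv_cancel, h1] at e4 e5
    rw [List.prod_cons, List.length_cons, commutatorElement_def]
    rw [abs_le] at *
    push_cast
    omega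

lemma hasInfiniteCommutatorWidth_of_quasimorphism {G : Type*} [Group G] (φ : G → ℤ) (h1 : φ 1 = 0)
    (hφ : ∀ g h, |φ (g * h) - φ g - φ h| ≤ 1) (hunb : ∀ n : ℤ, ∃ g ∈ commutator G, n ≤ φ g) :
    HasInfiniteCommutatorWidth G := by
  intro n
  obtain ⟨g, hg, hn⟩ := hunb (6 * n)
  refine ⟨g, hg, fun k hk hprod => ?_⟩
  have := (le_abs_self _).trans (abs_le_of_isProductOfCommutators φ h1 hφ hprod)
  omega

/-- The displacement of the point `p` is a quasimorphism, unbounded on the powers of an element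
that moves `p` beyond `T p`. -/
lemma CoveringContraction.hasInfiniteCommutatorWidth {E : Type*} [LinearOrder E] {T : E ≃o E}
    {K₁ K₂ : Subgroup (E ≃o E)} {P₁ P₂ : Set E} {p q : E}
    (H : CoveringContraction T K₁ K₂ P₁ P₂ p q) {deg : E → ℤ} (hd : IsDegree T deg)
    (hperf : K₁ ⊔ K₂ ≤ ⁅K₁ ⊔ K₂, K₁ ⊔ K₂⁆) :
    HasInfiniteCommutatorWidth (K₁ ⊔ K₂ : Subgroup (E ≃o E)) := by
  obtain ⟨g, hgΓ, hg⟩ := H.exists_translation_lt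
  have hpow : ∀ n : ℕ, deg p + n ≤ deg ((g ^ n) p) := by
    intro n
    induction n with
    | zero => simp
    | succ n ih =>
      have h1 := hd.monotone ((OrderIso.lt_iff_lt (g ^ n)).2 hg).le
      have h2 := map_zpow_of_commute ((H.commute g hgΓ).pow_left n) 1 p
      rw [zpow_one] at h2
      rw [h2, hd.map_translation, ← RelIso.mul_apply, ← pow_succ] at h1
      push_cast; omega
  refine hasInfiniteCommutatorWidth_of_quasimorphism (fun g => deg (g.1 p) - deg p) (by simp)
    (fun g h => ?_) (fun n => ⟨⟨g ^ n.toNat, pow_mem hgΓ _⟩, ?_, ?_⟩)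
  · have := hd.quasimorphism (H.commute g.1 g.2) p (h.1 p)
    rw [show deg ((g * h).1 p) = deg (g.1 (h.1 p)) from rfl]
    rw [abs_le] at this ⊢
    omega
  · have h1 := hperf (pow_mem hgΓ n.toNat)
    rw [← Subgroup.map_subtype_commutator] at h1
    obtain ⟨x, hx, hxe⟩ := h1
    rwa [show (⟨g ^ n.toNat, pow_mem hgΓ _⟩ : (K₁ ⊔ K₂ : Subgroup (E ≃o E))) = x from
      Subtype.ext hxe.symm]
  · have := hpow n.toNat
    have := Int.self_le_toNat n
    change n ≤ deg ((g ^ n.toNat) p) - deg p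
    omega

/-! ### Left orderability of groups of automorphisms of a countable line -/

/-- Automorphisms are compared at the first point, in an enumeration of the line, where they
differ. -/
lemma isLeftOrderable_subgroup_orderIso {E : Type*} [LinearOrder E] [Countable E] [Nonempty E]
    (Γ : Subgroup (E ≃o E)) : IsLeftOrderable Γ := by
  obtain ⟨e, he⟩ := exists_surjective_nat E
  let F : Γ → Lex (ℕ → E) := fun g => toLex fun n => g.1 (e n)
  have hF : Function.Injective F := by
    intro g h hgh
    refine Subtype.ext (RelIso.ext fun x => ?_)
    obtain ⟨n, rfl⟩ := he x
    exact congrFun hgh n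
  refine ⟨LinearOrder.lift' F hF, fun a b c hbc => ?_⟩
  obtain ⟨n, hn, hlt⟩ : ∃ n, (∀ m < n, b.1 (e m) = c.1 (e m)) ∧ b.1 (e n) < c.1 (e n) := hbc
  exact ⟨n, fun m hm => congrArg a.1 (hn m hm), (OrderIso.lt_iff_lt a.1).2 hlt⟩

/-! ### The group -/

namespace ColourDense

variable {α ι : Type*} [LinearOrder α] {κ : α → ι}

lemma denselyOrdered (h : ColourDense κ) : DenselyOrdered α :=
  ⟨fun a b hab => let ⟨c, h1, h2, _⟩ := h.between a b hab (κ a); ⟨c, h1, h2⟩⟩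

lemma noMinOrder (h : ColourDense κ) : NoMinOrder α :=
  ⟨fun a => let ⟨c, h1, _⟩ := h.below a (κ a); ⟨c, h1⟩⟩

lemma noMaxOrder (h : ColourDense κ) : NoMaxOrder α :=
  ⟨fun a => let ⟨c, h1, _⟩ := h.above a (κ a); ⟨c, h1⟩⟩

end ColourDense

/-- A circle cut open at a point: the lifted line, on which `projectiveGroup` acts, followed by a
spare interval, which it fixes. -/
abbrev CutCircle : Type := LiftedLine ⊕ₗ ColouredReal

namespace CutCircle

/-- The colour of a point of the cut circle. -/
noncomputable def colour (x : CutCircle) : ℤ :=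
  Sum.elim LiftedLine.colour ColouredReal.colour (ofLex x)

lemma colourDense : ColourDense colour := by
  have h : ColourDense LiftedLine.colour := by
    have := ColouredReal.colourDense.prodLex (L := ℤ) 0
    simp only [Pi.zero_apply, zero_add] at this
    exact this
  exact h.sumLex ColouredReal.colourDense

instance : Countable LiftedLine := inferInstanceAs (Countable (ℤ × ColouredReal))

instance : Countable CutCircle := inferInstanceAs (Countable (LiftedLine ⊕ ColouredReal))

/-- The periodic extension of an automorphism of the lifted line to the universal cover of the
circle. -/
noncomputable def extend : (LiftedLine ≃o LiftedLine) →* (ℤ ×ₗ CutCircle ≃o ℤ ×ₗ CutCircle) where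
  toFun g := Prod.Lex.prodLexCongr (OrderIso.refl ℤ)
    (OrderIso.sumLexCongr g (OrderIso.refl ColouredReal))
  map_one' := by
    refine RelIso.ext fun e => ?_
    induction e using Lex.rec with | _ e => ?_
    obtain ⟨n, x⟩ := e
    induction x using Lex.rec with | _ x => ?_
    rcases x with x | x <;> rfl
  map_mul' g h := by
    refine RelIso.ext fun e => ?_
    induction e using Lex.rec with | _ e => ?_
    obtain ⟨n, x⟩ := e
    induction x using Lex.rec with | _ x => ?_
    rcases x with x | x <;> rfl

/-- A point of the lifted line, as a point of the universal cover of the circle. -/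
abbrev inl (n : ℤ) (y : LiftedLine) : ℤ ×ₗ CutCircle := toLex (n, Sum.inlₗ y)

/-- A point of the spare interval, as a point of the universal cover of the circle. -/
abbrev inr (n : ℤ) (x : ColouredReal) : ℤ ×ₗ CutCircle := toLex (n, Sum.inrₗ x)

lemma extend_inl (g : LiftedLine ≃o LiftedLine) (n y) : extend g (inl n y) = inl n (g y) := rfl

lemma extend_inr (g : LiftedLine ≃o LiftedLine) (n x) : extend g (inr n x) = inr n x := rfl

lemma eq_inl_or_inr (e : ℤ ×ₗ CutCircle) : (∃ n y, e = inl n y) ∨ ∃ n x, e = inr n x := by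
  induction e using Lex.rec with | _ e => ?_
  obtain ⟨n, x⟩ := e
  induction x using Lex.rec with | _ x => ?_
  rcases x with x | x
  · exact .inl ⟨n, x, rfl⟩
  · exact .inr ⟨n, x, rfl⟩

lemma inl_lt_inl {n : ℤ} {y z : LiftedLine} : inl n y < inl n z ↔ y < z := by
  rw [Prod.Lex.lt_iff]; simp

lemma inr_lt_inr {n : ℤ} {y z : ColouredReal} : inr n y < inr n z ↔ y < z := by
  rw [Prod.Lex.lt_iff]; simp

lemma commute_extend (g : LiftedLine ≃o LiftedLine) : Commute (extend g) shift :=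
  RelIso.ext fun _ => rfl

lemma extend_mem_colourAut {g : LiftedLine ≃o LiftedLine} (hg : g ∈ colourAut LiftedLine.colour) :
    extend g ∈ colourAut (liftColour colour) := by
  intro e
  rcases eq_inl_or_inr e with ⟨n, y, rfl⟩ | ⟨n, x, rfl⟩
  · exact congrArg (n + ·) (hg y)
  · rfl

lemma isDegree : IsDegree (shift : ℤ ×ₗ CutCircle ≃o _) (fun e => (ofLex e).1) where
  monotone := Prod.Lex.monotone_fst_ofLex
  map_translation _ := rfl

lemma liftColour_shift (e : ℤ ×ₗ CutCircle) :
    liftColour colour (shift e) = liftColour colour e + 1 := by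
  simp only [liftColour, shift_apply, ofLex_toLex]; ring

/-- The part of the cut circle below the lift of `∞` between the levels `0` and `1`. -/
def low : Set CutCircle := {x | ∃ y : LiftedLine, y.level ≤ 0 ∧ x = Sum.inlₗ y}

lemma inl_mem_low {y : LiftedLine} : Sum.inlₗ y ∈ low ↔ y.level ≤ 0 :=
  ⟨fun ⟨_, hz, h⟩ => by rwa [Sum.inl_injective (toLex.injective h)], fun h => ⟨y, h, rfl⟩⟩

lemma inr_notMem_low (x : ColouredReal) : Sum.inrₗ x ∉ low := fun ⟨_, _, h⟩ =>
  absurd (toLex.injective h) Sum.inr_ne_inl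

lemma isLowerSet_low : IsLowerSet low := by
  rintro a b hba ⟨y, hy, rfl⟩
  induction b using Lex.rec with | _ b => ?_
  rcases b with b | b
  · exact inl_mem_low.2 ((LiftedLine.level_mono (Sum.Lex.inl_le_inl_iff.1 hba)).trans hy)
  · exact absurd hba Sum.Lex.not_inr_le_inl

lemma low_noMax : ∀ x ∈ low, ∃ y ∈ low, x < y := by
  rintro _ ⟨y, hy, rfl⟩
  refine ⟨Sum.inlₗ (LiftedLine.translation y), inl_mem_low.2 ?_, Sum.Lex.inl_lt_inl_iff.2 ?_⟩
  · rwa [LiftedLine.level_translation]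
  · exact LiftedLine.lt_translation y

lemma compl_low_noMin : ∀ x ∉ low, ∃ y ∉ low, y < x := by
  intro x hx
  induction x using Lex.rec with | _ x => ?_
  rcases x with x | x
  · refine ⟨Sum.inlₗ (LiftedLine.translation⁻¹ x), fun h => hx ?_,
      Sum.Lex.inl_lt_inl_iff.2 (LiftedLine.translation_inv_lt x)⟩
    rw [inl_mem_low, ← LiftedLine.level_translation, RelIso.apply_inv_self] at h
    exact inl_mem_low.2 h
  · obtain ⟨c, hc, -⟩ := ColouredReal.colourDense.below x 0
    exact ⟨Sum.inrₗ c, inr_notMem_low c, Sum.Lex.inr_lt_inr_iff.2 hc⟩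

/-- The arc of the circle on which `projectiveGroup` contracts, lifted to the universal cover. -/
def arc : Set (ℤ ×ₗ CutCircle) := inl 0 '' LiftedLine.chart

lemma ordConnected_arc : arc.OrdConnected := by
  refine ⟨?_⟩
  rintro _ ⟨y, hy, rfl⟩ _ ⟨z, hz, rfl⟩ e he
  have h1 := Prod.Lex.le_iff'.1 he.1
  have h2 := Prod.Lex.le_iff'.1 he.2
  simp only [ofLex_toLex] at h1 h2
  have h0 : (ofLex e).1 = 0 := le_antisymm h2.1 h1.1
  rcases eq_inl_or_inr e with ⟨n, x, rfl⟩ | ⟨n, x, rfl⟩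
  · obtain rfl : n = 0 := h0
    exact ⟨x, LiftedLine.ordConnected_chart.out hy hz
      ⟨Sum.Lex.inl_le_inl_iff.1 (h1.2 rfl), Sum.Lex.inl_le_inl_iff.1 (h2.2 rfl)⟩, rfl⟩
  · exact absurd (h2.2 h0) Sum.Lex.not_inr_le_inl

lemma arc_noMin : ∀ x ∈ arc, ∃ y ∈ arc, y < x := by
  rintro _ ⟨y, hy, rfl⟩
  obtain ⟨z, hz, hzy⟩ := LiftedLine.chart_noMin y hy
  exact ⟨_, ⟨z, hz, rfl⟩, inl_lt_inl.2 hzy⟩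

lemma arc_noMax : ∀ x ∈ arc, ∃ y ∈ arc, x < y := by
  rintro _ ⟨y, hy, rfl⟩
  obtain ⟨z, hz, hzy⟩ := LiftedLine.chart_noMax y hy
  exact ⟨_, ⟨z, hz, rfl⟩, inl_lt_inl.2 hzy⟩

/-- The action of `projectiveGroup` on the universal cover of the circle. -/
noncomputable def arcGroup : Subgroup (ℤ ×ₗ CutCircle ≃o ℤ ×ₗ CutCircle) :=
  LiftedLine.projectiveGroup.map extend

lemma arcGroup_contract {p q : ℤ ×ₗ CutCircle} (hp : p ∈ arc) (hq : q ∈ arc) :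
    ∀ a ∈ arc, ∀ b ∈ arc, a < b → ∃ k ∈ arcGroup, ∀ y ∈ Set.Icc p q, k y ∈ Set.Ioo a b := by
  rintro _ ⟨a, ha, rfl⟩ _ ⟨b, hb, rfl⟩ hab
  obtain ⟨p, hp', rfl⟩ := hp
  obtain ⟨q, hq', rfl⟩ := hq
  obtain ⟨k, hk, h⟩ := LiftedLine.exists_contraction hp' hq' ha hb (inl_lt_inl.1 hab)
  refine ⟨extend k, Subgroup.mem_map_of_mem _ hk, fun y hy => ?_⟩
  obtain ⟨y, -, rfl⟩ := ordConnected_arc.out ⟨p, hp', rfl⟩ ⟨q, hq', rfl⟩ hy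
  have h1 : p ≤ y := not_lt.1 fun h => hy.1.not_gt (inl_lt_inl.2 h)
  have h2 : y ≤ q := not_lt.1 fun h => hy.2.not_gt (inl_lt_inl.2 h)
  rw [extend_inl]
  exact ⟨inl_lt_inl.2 (h y h1 h2).1, inl_lt_inl.2 (h y h1 h2).2⟩

lemma arcGroup_commute : ∀ k ∈ arcGroup, Commute k shift := by
  rintro _ ⟨g, -, rfl⟩
  exact commute_extend g

lemma arcGroup_le_colourAut : arcGroup ≤ colourAut (liftColour colour) := by
  rintro _ ⟨g, hg, rfl⟩
  exact extend_mem_colourAut (LiftedLine.projectiveGroup_le_colourAut hg)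

lemma fg_map {G H : Type*} [Group G] [Group H] (f : G →* H) {K : Subgroup G} (hK : K.FG) :
    (K.map f).FG := by
  obtain ⟨S, rfl, hS⟩ := (Subgroup.fg_iff K).1 hK
  exact (Subgroup.fg_iff _).2 ⟨f '' S, (MonoidHom.map_closure f S).symm, hS.image f⟩

lemma map_le_commutator {G H : Type*} [Group G] [Group H] (f : G →* H) {K : Subgroup G}
    (hK : K ≤ ⁅K, K⁆) : K.map f ≤ ⁅K.map f, K.map f⁆ := by
  rw [← Subgroup.map_commutator]
  exact Subgroup.map_mono hK

lemma arcGroup_le_commutator : arcGroup ≤ ⁅arcGroup, arcGroup⁆ :=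
  map_le_commutator _ LiftedLine.projectiveGroup_le_commutator

/-- There is an automorphism `σ` of the universal cover, commuting with the translation and lowering
colours by `1`, and there are points `p < q` of the arc such that `σ` maps the complementary
interval `[q, T p]` into `[p, q]`. Although `σ` changes
colours, its conjugation action keeps colour-preserving automorphisms colour-preserving. -/
lemma exists_gluing : ∃ (σ : ℤ ×ₗ CutCircle ≃o ℤ ×ₗ CutCircle) (p q : ℤ ×ₗ CutCircle),
    Commute σ shift ∧ (∀ e, liftColour colour (σ e) = liftColour colour e - 1) ∧
    p ∈ arc ∧ q ∈ arc ∧ p < q ∧ q < shift p ∧ p ≤ σ q ∧ σ (shift p) ≤ q := by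
  obtain ⟨xp, hxp, -⟩ := ColouredReal.exists_between_real (zero_lt_one' ℝ) 0
  obtain ⟨xq, -, hxq, -⟩ := ColouredReal.exists_between_real (neg_one_lt_zero (R := ℝ)) 0
  obtain ⟨yp, hyp, hyp'⟩ := ColouredReal.colourDense.below xq xp.colour
  obtain ⟨yq, hyq, hyq'⟩ := ColouredReal.colourDense.above xp (xq.colour - 1)
  have hpq : LiftedLine.mk 0 xp < LiftedLine.mk 1 xq :=
    LiftedLine.mk_lt_mk.2 (.inl zero_lt_one)
  obtain ⟨ρ, hρ, hρc, hρp, hρq⟩ := exists_periodic_automorphism colourDense isLowerSet_low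
    low_noMax compl_low_noMin (Sum.Lex.inl_lt_inl_iff.2 hpq)
    (p' := Sum.inlₗ (LiftedLine.mk 1 yp)) (q' := Sum.inlₗ (LiftedLine.mk 0 yq))
    (fun h => absurd (inl_mem_low.1 h) (by simp)) (inl_mem_low.2 (by simp)) hyp'
    (by change 1 + yq.colour = xq.colour; omega)
  have hσ : Commute (shift⁻¹ * ρ) shift := (Commute.refl shift).inv_left.mul_left hρ
  refine ⟨shift⁻¹ * ρ, inl 0 (LiftedLine.mk 0 xp), inl 0 (LiftedLine.mk 1 xq), hσ, fun e => ?_,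
    ⟨LiftedLine.mk 0 xp, LiftedLine.mem_chart_iff.2 (.inl ⟨rfl, hxp⟩), rfl⟩,
    ⟨LiftedLine.mk 1 xq, LiftedLine.mem_chart_iff.2 (.inr ⟨rfl, hxq⟩), rfl⟩,
    inl_lt_inl.2 hpq, ?_, ?_, ?_⟩
  · have h := liftColour_shift (shift⁻¹ (ρ e))
    rw [RelIso.apply_inv_self, hρc e] at h
    rw [RelIso.mul_apply]; omega
  · exact isDegree.lt_of_deg_lt (Int.lt_succ 0)
  · rw [RelIso.mul_apply, hρq, show toLex ((1 : ℤ), Sum.inlₗ (LiftedLine.mk 0 yq)) =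
      shift (inl 0 (LiftedLine.mk 0 yq)) from rfl, RelIso.inv_apply_self]
    exact (inl_lt_inl.2 (LiftedLine.mk_lt_mk.2 (.inr ⟨rfl, hyq⟩))).le
  · rw [← RelIso.mul_apply, hσ.eq, RelIso.mul_apply, RelIso.mul_apply, RelIso.apply_inv_self, hρp]
    exact (inl_lt_inl.2 (LiftedLine.mk_lt_mk.2 (.inr ⟨rfl, hyp⟩))).le

end CutCircle

open CutCircle

theorem corollary1p7 :
    ∃ (G : Type) (_ : Group G), Group.FG G ∧ IsSimpleGroup G ∧ IsLeftOrderable G ∧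
      HasInfiniteCommutatorWidth G := by
  obtain ⟨σ, p, q, hσ, hσc, hp, hq, hpq, hqp, hσq, hσp⟩ := exists_gluing
  have := (colourDense.prodLex id).denselyOrdered (α := ℤ ×ₗ CutCircle)
  have := (colourDense.prodLex id).noMinOrder (α := ℤ ×ₗ CutCircle)
  have := (colourDense.prodLex id).noMaxOrder (α := ℤ ×ₗ CutCircle)
  have : Countable (ℤ ×ₗ CutCircle) := inferInstanceAs (Countable (ℤ × CutCircle))
  have : Nonempty (ℤ ×ₗ CutCircle) := ⟨p⟩
  let K₁ := arcGroup
  let K₂ := arcGroup.map (MulAut.conj σ⁻¹).toMonoidHom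
  have hK₂ : ∀ {g}, g ∈ K₂ → ∃ k ∈ arcGroup, ∀ x, g x = σ⁻¹ (k (σ x)) := by
    rintro _ ⟨k, hk, rfl⟩
    exact ⟨k, hk, fun x => by simp [RelIso.mul_apply]⟩
  have hσlt : ∀ {x y}, σ x < σ y ↔ x < y := OrderIso.lt_iff_lt σ
  -- transport of the contraction property along `σ`
  have hout : ∀ x ∈ Set.Icc q (shift p), σ x ∈ Set.Icc p q := fun x hx =>
    ⟨hσq.trans ((OrderIso.le_iff_le σ).2 hx.1), ((OrderIso.le_iff_le σ).2 hx.2).trans hσp⟩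
  have H : CoveringContraction shift K₁ K₂ arc (σ ⁻¹' arc) p q :=
    { commute₁ := arcGroup_commute
      commute₂ := by
        rintro _ ⟨k, hk, rfl⟩
        simpa using (hσ.inv_left.mul_left (arcGroup_commute k hk)).mul_left hσ
      ordConnected₁ := ordConnected_arc
      ordConnected₂ := ordConnected_arc.preimage_mono σ.monotone
      noMin₁ := arc_noMin
      noMax₁ := arc_noMax
      noMin₂ := fun x hx => by
        obtain ⟨y, hy, hyx⟩ := arc_noMin _ hx
        obtain ⟨y, rfl⟩ := σ.surjective y
        exact ⟨y, hy, hσlt.1 hyx⟩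
      noMax₂ := fun x hx => by
        obtain ⟨y, hy, hyx⟩ := arc_noMax _ hx
        obtain ⟨y, rfl⟩ := σ.surjective y
        exact ⟨y, hy, hσlt.1 hyx⟩
      lt₁ := hpq
      lt₂ := hqp
      mem_p := hp
      mem_q := hq
      mem_q' := ordConnected_arc.out hp hq (hout _ ⟨le_rfl, hqp.le⟩)
      mem_Tp := ordConnected_arc.out hp hq (hout _ ⟨hqp.le, le_rfl⟩)
      contract₁ := arcGroup_contract hp hq
      contract₂ := fun a ha b hb hab => by
        obtain ⟨k, hk, h⟩ := arcGroup_contract hp hq _ ha _ hb (hσlt.2 hab)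
        refine ⟨_, Subgroup.mem_map_of_mem _ hk, fun y hy => ?_⟩
        have := h _ (hout y hy)
        have e : (MulAut.conj σ⁻¹).toMonoidHom k y = σ⁻¹ (k (σ y)) := by simp [RelIso.mul_apply]
        rw [e]
        constructor
        · rw [← hσlt, RelIso.apply_inv_self]; exact this.1
        · rw [← hσlt, RelIso.apply_inv_self]; exact this.2 }
  let K : Bool → Subgroup (ℤ ×ₗ CutCircle ≃o ℤ ×ₗ CutCircle) := fun i => cond i K₁ K₂
  let Γ := K₁ ⊔ K₂
  have hΓK : Γ = ⨆ i, K i := (iSup_bool_eq (f := K)).symm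
  have hperf : ∀ i, K i ≤ ⁅K i, K i⁆ := by
    rintro (_ | _)
    · exact map_le_commutator _ arcGroup_le_commutator
    · exact arcGroup_le_commutator
  have hΓc : Γ ≤ colourAut (liftColour colour) := by
    refine sup_le arcGroup_le_colourAut fun g hg x => ?_
    obtain ⟨k, hk, h⟩ := hK₂ hg
    have h1 := hσc (σ⁻¹ (k (σ x)))
    rw [RelIso.apply_inv_self, arcGroup_le_colourAut hk, hσc] at h1
    rw [h]; omega
  -- the supports of the two groups: the lifted line and its preimage
  let V : Set (ℤ ×ₗ CutCircle) := {e | ∃ n y, e = inl n y}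
  let U : Bool → Set (ℤ ×ₗ CutCircle) := fun i => cond i V (σ ⁻¹' V)
  have hV : ∀ k ∈ arcGroup, ∀ x ∉ V, k x = x := by
    rintro _ ⟨g, -, rfl⟩ x hx
    rcases eq_inl_or_inr x with h | ⟨n, y, rfl⟩
    · exact absurd h hx
    · exact extend_inr g n y
  have hU : ∀ i, ∀ k ∈ K i, ∀ x ∉ U i, k x = x := by
    rintro (_ | _)
    · intro g hg x hx
      obtain ⟨k, hk, h⟩ := hK₂ hg
      rw [h, hV k hk _ hx, RelIso.inv_apply_self]
    · exact hV
  obtain ⟨c, hc, -⟩ := ColouredReal.colourDense.above (ColouredReal.gen 0) 0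
  have hVshift : ∀ x ∈ V, ∀ n : ℤ,
      (shift ^ n) x ∉ Set.Ioo (inr 0 (ColouredReal.gen 0)) (inr 0 c) := by
    rintro _ ⟨m, y, rfl⟩ n hn
    rw [shift_zpow_apply] at hn
    have h1 := Prod.Lex.lt_iff'.1 hn.1
    have h2 := Prod.Lex.lt_iff'.1 hn.2
    simp only [ofLex_toLex] at h1 h2
    exact absurd (h1.2 (le_antisymm h1.1 h2.1)) Sum.Lex.not_inr_lt_inl
  have hcomp : ∀ i a b, a < b →
      ∃ g ∈ Γ, ∀ x ∈ U i, ∃ n : ℤ, (shift ^ n) (g x) ∈ Set.Ioo a b := by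
    rintro (_ | _) a b hab
    · refine H.exists_compress_set isDegree
        ((OrderIso.lt_iff_lt σ⁻¹).2 (inr_lt_inr (n := 0).2 hc)) (fun x hx n hn => ?_) hab
      refine hVshift _ hx n ?_
      rw [← map_zpow_of_commute hσ]
      constructor
      · have := hσlt.2 hn.1
        rwa [RelIso.apply_inv_self] at this
      · have := hσlt.2 hn.2
        rwa [RelIso.apply_inv_self] at this
    · exact H.exists_compress_set isDegree (inr_lt_inr.2 hc) hVshift hab
  have hΓperf : Γ ≤ ⁅Γ, Γ⁆ := by
    refine hΓK.trans_le (iSup_le fun i => (hperf i).trans ?_)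
    have h : K i ≤ Γ := hΓK ▸ le_iSup K i
    exact Subgroup.commutator_mono h h
  refine ⟨Γ, inferInstance, ?_, ?_, isLeftOrderable_subgroup_orderIso Γ,
    H.hasInfiniteCommutatorWidth isDegree hΓperf⟩
  · rw [Group.fg_iff_subgroup_fg]
    have h1 : arcGroup.FG := fg_map _ LiftedLine.projectiveGroup_fg
    exact h1.sup (fg_map _ h1)
  · refine isSimpleGroup_of_le_of_normalized (fun hbot => ?_) fun N hN f hfN hfΓ hf1 =>
      le_of_normalized isDegree liftColour_shift H.commute hΓc K U hΓK hperf hU hcomp hN hfN hfΓ hf1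
    obtain ⟨g, hgΓ, hg⟩ := H.exists_translation_lt
    have h1 : g = 1 := Subgroup.mem_bot.1 (hbot ▸ hgΓ)
    rw [h1] at hg
    exact lt_asymm hg (hpq.trans hqp)
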